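/- **Setting.** Identify $\mathbb C$ with $\mathbb R^2$ (basis $e_1=1$, $e_2=i$). A pointed $k$-chain ($k=0,1,2$) is a finite formal sum $A=\sum_i(p_i;\alpha_i)$ with $p_i\in\mathbb R^2$, $\alpha_i\in\Lambda^k\mathbb R^2$, i.e. a finitely supported section of the bundle of $k$-vectors. For $u\in\mathbb R^2$ let $\Delta_u(p;\alpha)=(p+u;\alpha)-(p;\alpha)$, and for $U=(u_1,\dots,u_j)$ let $\Delta_U^j=\Delta_{u_1}\circ\cdots\circ\Delta_{u_j}$ and $|\Delta^j_U(p;\alpha)|_j=\|u_1\|\cdots\|u_j\|\,\|\alpha\|$. For $r\ge 0$ put $$\|A\|_{B^r}=\inf\Big\{\sum_i|\Delta_{U_i}^{j_i}(p_i;\alpha_i)|_{j_i} : A=\sum_i\Delta_{U_i}^{j_i}(p_i;\alpha_i),\ 0\le j_i\le r\Big\},$$ and let $\hat{\mathcal B}^r_k$ (differential $k$-chains of order $r$) be the completion of the pointed $k$-chains in $\|\cdot\|_{B^r}$; there are canonical maps $\hat{\mathcal B}^r_k\to\hat{\mathcal B}^{r+1}_k$. The boundary $\partial:\hat{\mathcal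 B}^r_k\to\hat{\mathcal B}^{r+1}_{k-1}$, $r\ge1$, is $\partial=P_{e_1}E^\dagger_{e_1}+P_{e_2}E^\dagger_{e_2}$, where $P_v(p;\alpha)=\lim_{t\to0}\Delta_{tv}(p;\alpha/t)$ and $E_v^\dagger(p;v_1\wedge\dots\wedge v_k)=\sum_i(-1)^{i+1}\langle v,v_i\rangle(p;v_1\wedge\cdots\widehat{v_i}\cdots\wedge v_k)$; $J$ is closed if $\partial J=0$. For $K\in\hat{\mathcal B}^{r-1}_2$ and $J\in\hat{\mathcal B}^r_1$ the equation $\partial K=J$ is read after mapping both chains to the next higher order (which is needed only if $r=1$). A closed set $X$ supports a chain $J\in \hat{\mathcal B}^r_k$ if for each non-empty open $W\supseteq X$, $J$ is a limit in $\hat{\mathcal B}^r_k$ of pointed chains in $W$; $\operatorname{supp}J$ is the intersection of all closed sets supporting $J$. The mass of $K$ is $\inf\{\liminf_i\|A_i\|_{B^0}: A_i\to K,\ A_i \text{ pointed chains}\}$. Let $\mathcal B_k^r$ be the space of $k$-forms $\omega$ (real or complex valued) for which $|\omega(\Delta^j_U(p;\alpha))|\le C|\Delta^j_U(p;\alpha)|_j$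 for some $C$ and all $0\le j\le r$. The Harrison integral $J\mapsto\int_J\omega$, $\omega\in\mathcal B_k^r$, is the continuous extension to $\hat{\mathcal B}^r_k$ of $\sum(p_i;\alpha_i)\mapsto\sum\omega_{p_i}(\alpha_i)$. If $\omega$ is only given near $\operatorname{supp}J$, then $\int_J\omega$ is defined, with value $I$, if some element of $\mathcal B^r_k$ agrees with $\omega$ on a neighbourhood of $\operatorname{supp}J$ and every such element has integral $I$ over $J$. For $z\notin\operatorname{supp}J$ let $\operatorname{Ind}_J(z)=\frac1{2\pi i}\int_J\frac{dw}{w-z}$. For an open set $D$ of finite area, $\widetilde D=\int_D(p;e_1\wedge e_2)\,dp\in\hat{\mathcal B}^1_2$ is the $2$-chain representing $D$. **Theorem (Generalized Cauchy Residue Theorem).** Let $r\ge1$, let $U\subset\mathbb C$ be bounded and open, and let $J\in\hat{\mathcal B}_1^r(\mathbb R^2)$ be closed with $\operatorname{supp}J\subseteq U$ and $\operatorname{Ind}_J(w)=0$ for all $w\notin U$. Suppose that there is $K\in\hat{\mathcal B}_2^{r-1}(\mathbb R^2)$ of finite mass with $\partial K=J$. Let $f$ be holomorphic on $U$ except at finitely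 many distinct points $a_k\in U\setminus\operatorname{supp}J$. For each $k$ let $D_k$ be an open neighbourhood of $a_k$ with $\overline{D_k}\subset U$ and $a_l\notin\overline{D_k}$ for all $l\neq k$ (for instance a small disk around $a_k$). Then $\int_J f\,dz$ and $\int_{\partial\widetilde{D_k}}f\,dz$ are defined, and $$\int_J f(z)\,dz=\sum_k\operatorname{Ind}_J(a_k)\int_{\partial\widetilde{D_k}}f(z)\,dz .$$ -/

import Mathlib

open Filter Topology MeasureTheory UniformSpace
open scoped ENNReal Pointwise

set_option linter.unusedSectionVars false

noncomputable section

namespace DiffChain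

/-! ## Pointed chains in the plane

The plane `ℝ²` is `ℂ`, with orthonormal basis `1, I`.  A pointed chain is a finitely supported
section of the bundle of `k`-vectors, i.e. a finitely supported function `ℂ →₀ V`, where `V` is the
normed space of `k`-vectors of `ℝ²` with its mass norm.  In the plane every `k`-vector is simple, so
the mass of a `k`-vector is its `k`-volume:

* `0`-vectors: `V = ℝ` with `|·|`;
* `1`-vectors: `V = ℂ` with the Euclidean norm;
* `2`-vectors: `V = ℝ` with `|·|`, where `c : ℝ` stands for `c • (e₁ ∧ e₂)`, `e₁ = 1`, `e₂ = I`. -/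

/-- `0`-vectors of the plane. -/
abbrev Vec0 : Type := ℝ

/-- `1`-vectors of the plane. -/
abbrev Vec1 : Type := ℂ

/-- `2`-vectors of the plane: `c` is the `2`-vector `c • (e₁ ∧ e₂)`. -/
abbrev Vec2 : Type := ℝ

section Pointed

variable {V W : Type} [NormedAddCommGroup V] [NormedSpace ℝ V]
  [NormedAddCommGroup W] [NormedSpace ℝ W]

/-- The translation operator `T_u : (p; α) ↦ (p + u; α)`. -/
def translate (u : ℂ) : (ℂ →₀ V) →ₗ[ℝ] (ℂ →₀ V) :=
  Finsupp.lmapDomain V ℝ (fun p => p + u)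

/-- The difference operator `Δ_u = T_u - Id`. -/
def difference (u : ℂ) : (ℂ →₀ V) →ₗ[ℝ] (ℂ →₀ V) :=
  translate u - LinearMap.id

/-- The iterated difference operator `Δ_U = Δ_{u₁} ∘ ⋯ ∘ Δ_{u_j}` for `U = [u₁, …, u_j]`. -/
def iterDifference : List ℂ → (ℂ →₀ V) →ₗ[ℝ] (ℂ →₀ V)
  | [] => LinearMap.id
  | u :: U => difference u ∘ₗ iterDifference U

/-- The data `(U, p, α)` of a difference chain `Δ_U (p; α)`. -/
structure DiffElement (V : Type) where
  /-- the list `U` of directions -/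
  dirs : List ℂ
  /-- the base point `p` -/
  base : ℂ
  /-- the `k`-vector `α` -/
  vec : V

/-- The difference chain `Δ_U (p; α)`, as a pointed chain. -/
def DiffElement.chain (e : DiffElement V) : ℂ →₀ V :=
  iterDifference e.dirs (Finsupp.single e.base e.vec)

/-- The order `j` of `Δ_U^j (p; α)`. -/
def DiffElement.order (e : DiffElement V) : ℕ := e.dirs.length

/-- `|Δ_U^j (p; α)|_j = ‖u₁‖ ⋯ ‖u_j‖ ‖α‖`. -/
def DiffElement.size (e : DiffElement V) : ℝ :=
  (e.dirs.map (fun u => ‖u‖)).prod * ‖e.vec‖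

/-- The values `∑ᵢ |Δ_{Uᵢ} (pᵢ; αᵢ)|` over all ways of writing `A = ∑ᵢ Δ_{Uᵢ} (pᵢ; αᵢ)` with
difference chains of order at most `r`. -/
def sizeSet (r : ℕ) (A : ℂ →₀ V) : Set ℝ :=
  {x | ∃ l : List (DiffElement V), (∀ e ∈ l, e.order ≤ r) ∧
    A = (l.map DiffElement.chain).sum ∧ x = (l.map DiffElement.size).sum}

/-- The `r`-norm `‖A‖_{B^r}` of a pointed chain; for `r = 0` it is the mass norm. -/
def rNorm (r : ℕ) (A : ℂ →₀ V) : ℝ := sInf (sizeSet r A)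

theorem DiffElement.size_nonneg (e : DiffElement V) : 0 ≤ e.size :=
  mul_nonneg (List.prod_nonneg (by simp)) (norm_nonneg _)

theorem sum_size_nonneg (l : List (DiffElement V)) : 0 ≤ (l.map DiffElement.size).sum :=
  List.sum_nonneg (by
    intro x hx
    obtain ⟨e, -, rfl⟩ := List.mem_map.1 hx
    exact e.size_nonneg)

theorem sizeSet_bddBelow (r : ℕ) (A : ℂ →₀ V) : BddBelow (sizeSet r A) :=
  ⟨0, by rintro x ⟨l, -, -, rfl⟩; exact sum_size_nonneg l⟩

theorem sizeSet_nonempty (r : ℕ) (A : ℂ →₀ V) : (sizeSet r A).Nonempty := by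
  induction A using Finsupp.induction_linear with
  | zero => exact ⟨0, [], by simp, by simp, by simp⟩
  | add A B hA hB =>
    obtain ⟨_, l, hl, rfl, rfl⟩ := hA
    obtain ⟨_, m, hm, rfl, rfl⟩ := hB
    refine ⟨_, l ++ m, ?_, by simp, rfl⟩
    intro e he
    rcases List.mem_append.1 he with h | h
    exacts [hl e h, hm e h]
  | single p α => exact ⟨_, [⟨[], p, α⟩], by simp [DiffElement.order],
      by simp [DiffElement.chain, iterDifference], rfl⟩

theorem rNorm_nonneg (r : ℕ) (A : ℂ →₀ V) : 0 ≤ rNorm r A :=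
  le_csInf (sizeSet_nonempty r A) (by rintro x ⟨l, -, -, rfl⟩; exact sum_size_nonneg l)

theorem rNorm_chain_le {r : ℕ} (e : DiffElement V) (he : e.order ≤ r) :
    rNorm r e.chain ≤ e.size :=
  csInf_le (sizeSet_bddBelow r _) ⟨[e], by simpa using he, by simp, by simp⟩

theorem rNorm_add_le (r : ℕ) (A B : ℂ →₀ V) : rNorm r (A + B) ≤ rNorm r A + rNorm r B := by
  rw [rNorm, rNorm, rNorm, ← csInf_add (sizeSet_nonempty r A) (sizeSet_bddBelow r A)
    (sizeSet_nonempty r B) (sizeSet_bddBelow r B)]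
  refine le_csInf ((sizeSet_nonempty r A).add (sizeSet_nonempty r B)) ?_
  rintro _ ⟨_, ⟨l, hl, rfl, rfl⟩, _, ⟨m, hm, rfl, rfl⟩, rfl⟩
  refine csInf_le (sizeSet_bddBelow r _) ⟨l ++ m, ?_, by simp, by simp⟩
  intro e he
  rcases List.mem_append.1 he with h | h
  exacts [hl e h, hm e h]

/-- A linear map that is bounded on the difference chains of order at most `r` is bounded for the
`r`-norm. -/
theorem bound_of_diffElement {X : Type*} [SeminormedAddCommGroup X] [Module ℝ X] {r : ℕ} {C : ℝ}
    (T : (ℂ →₀ V) →ₗ[ℝ] X)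
    (h : ∀ e : DiffElement V, e.order ≤ r → ‖T e.chain‖ ≤ C * e.size) (hC : 0 ≤ C)
    (A : ℂ →₀ V) : ‖T A‖ ≤ C * rNorm r A := by
  have key : ∀ x ∈ sizeSet r A, ‖T A‖ ≤ C * x := by
    rintro x ⟨l, hl, hA, rfl⟩
    rw [hA]
    clear hA
    induction l with
    | nil => simp
    | cons e l ih =>
      simp only [List.map_cons, List.sum_cons, map_add, mul_add]
      exact (norm_add_le _ _).trans (add_le_add (h e (hl e (by simp)))
        (ih fun e' he' => hl e' (by simp [he'])))
  rcases hC.eq_or_lt with rfl | hC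
  · obtain ⟨x, hx⟩ := sizeSet_nonempty r A
    simpa using key x hx
  · rw [← div_le_iff₀' hC]
    exact le_csInf (sizeSet_nonempty r A) fun x hx => (div_le_iff₀' hC).2 (key x hx)

theorem rNorm_smul_le (r : ℕ) (c : ℝ) (A : ℂ →₀ V) : rNorm r (c • A) ≤ |c| * rNorm r A := by
  have key : ∀ x ∈ sizeSet r A, rNorm r (c • A) ≤ |c| * x := by
    rintro x ⟨l, hl, rfl, rfl⟩
    refine csInf_le (sizeSet_bddBelow r _)
      ⟨l.map (fun e => ⟨e.dirs, e.base, c • e.vec⟩), ?_, ?_, ?_⟩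
    · intro e he
      obtain ⟨e', he', rfl⟩ := List.mem_map.1 he
      exact hl e' he'
    · clear hl
      induction l with
      | nil => simp
      | cons e l ih =>
        simp only [List.map_cons, List.sum_cons, smul_add, ih]
        congr 1
        simp [DiffElement.chain, ← Finsupp.smul_single, map_smul]
    · clear hl
      induction l with
      | nil => simp
      | cons e l ih =>
        simp only [List.map_cons, List.sum_cons, mul_add, ih]
        congr 1
        simp [DiffElement.size, norm_smul]
        ring
  rcases (abs_nonneg c).eq_or_lt with hc | hc
  · obtain ⟨x, hx⟩ := sizeSet_nonempty r A
    simpa [← hc] using key x hx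
  · rw [← div_le_iff₀' hc]
    exact le_csInf (sizeSet_nonempty r A) fun x hx => (div_le_iff₀' hc).2 (key x hx)

/-- The `r`-norm as a seminorm. -/
def rSeminorm (V : Type) [NormedAddCommGroup V] [NormedSpace ℝ V] (r : ℕ) :
    Seminorm ℝ (ℂ →₀ V) :=
  Seminorm.ofSMulLE (rNorm r)
    (le_antisymm (csInf_le (sizeSet_bddBelow r _) ⟨[], by simp, by simp, by simp⟩)
      (rNorm_nonneg r 0))
    (rNorm_add_le r) (fun c A => by simpa using rNorm_smul_le r c A)

/-- The space of pointed chains, equipped with the `r`-norm. -/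
def Pointed (V : Type) [NormedAddCommGroup V] [NormedSpace ℝ V] (_r : ℕ) : Type := ℂ →₀ V

instance (r : ℕ) : SeminormedAddCommGroup (Pointed V r) :=
  (rSeminorm V r).toAddGroupSeminorm.toSeminormedAddCommGroup

instance (r : ℕ) : Module ℝ (Pointed V r) := (inferInstance : Module ℝ (ℂ →₀ V))

instance (r : ℕ) : NormedSpace ℝ (Pointed V r) where
  norm_smul_le c A := rNorm_smul_le r c A

/-- A pointed chain as an element of the space with the `r`-norm. -/
def toPointed (r : ℕ) : (ℂ →₀ V) ≃ₗ[ℝ] Pointed V r := LinearEquiv.refl ℝ (ℂ →₀ V)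

theorem norm_toPointed (r : ℕ) (A : ℂ →₀ V) : ‖toPointed r A‖ = rNorm r A := rfl

/-- The Banach space of differential chains of order `r` in the plane with coefficients in the
`k`-vectors `V`: the completion of the pointed chains for the `r`-norm. -/
abbrev Chain (V : Type) [NormedAddCommGroup V] [NormedSpace ℝ V] (r : ℕ) : Type :=
  Completion (Pointed V r)

/-- The canonical map from pointed chains to differential chains of order `r`. -/
def toChain (r : ℕ) : (ℂ →₀ V) →ₗ[ℝ] Chain V r :=
  (Completion.toComplₗᵢ : Pointed V r →ₗᵢ[ℝ] Chain V r).toLinearMap ∘ₗ (toPointed r).toLinearMap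

theorem norm_toChain (r : ℕ) (A : ℂ →₀ V) : ‖toChain r A‖ = rNorm r A :=
  Completion.norm_coe _

/-- The continuous extension to `Chain V r` of a linear map on pointed chains that is bounded
for the `r`-norm. -/
def extendChain {X : Type} [NormedAddCommGroup X] [NormedSpace ℝ X] [CompleteSpace X] {r : ℕ}
    (T : (ℂ →₀ V) →ₗ[ℝ] X) (h : ∃ C : ℝ, ∀ A, ‖T A‖ ≤ C * rNorm r A) : Chain V r →L[ℝ] X :=
  ((T ∘ₗ (toPointed r).symm.toLinearMap).mkContinuousOfExistsBound h).fromCompletion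

theorem extendChain_toChain {X : Type} [NormedAddCommGroup X] [NormedSpace ℝ X] [CompleteSpace X]
    {r : ℕ} (T : (ℂ →₀ V) →ₗ[ℝ] X) (h : ∃ C : ℝ, ∀ A, ‖T A‖ ≤ C * rNorm r A) (A : ℂ →₀ V) :
    extendChain T h (toChain r A) = T A :=
  ContinuousLinearMap.fromCompletion_apply_coe _ _

/-! ## The operators -/

theorem rNorm_succ_le (r : ℕ) (A : ℂ →₀ V) : rNorm (r + 1) A ≤ rNorm r A :=
  csInf_le_csInf (sizeSet_bddBelow _ _) (sizeSet_nonempty _ _) (by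
    rintro x ⟨l, hl, h⟩
    exact ⟨l, fun e he => (hl e he).trans (Nat.le_succ r), h⟩)

/-- The canonical map from chains of order `r` to chains of order `r + 1`, which extends the
identity of pointed chains. -/
def incl (r : ℕ) : Chain V r →L[ℝ] Chain V (r + 1) :=
  extendChain (toChain (r + 1))
    ⟨1, fun A => by simpa [norm_toChain] using rNorm_succ_le r A⟩

theorem translate_single (u p : ℂ) (α : V) :
    translate u (Finsupp.single p α) = Finsupp.single (p + u) α := by
  simp [translate]

/-- A linear map `E : V → W` applied to the vectors of a pointed chain, `(p; α) ↦ (p; E α)`. -/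
def mapVecPointed (E : V →L[ℝ] W) : (ℂ →₀ V) →ₗ[ℝ] (ℂ →₀ W) :=
  Finsupp.mapRange.linearMap E.toLinearMap

theorem mapVecPointed_iterDifference (E : V →L[ℝ] W) (U : List ℂ) (A : ℂ →₀ V) :
    mapVecPointed E (iterDifference U A) = iterDifference U (mapVecPointed E A) := by
  induction U with
  | nil => rfl
  | cons u U ih =>
    have h : ∀ B : ℂ →₀ V,
        mapVecPointed E (difference u B) = difference u (mapVecPointed E B) := by
      intro B
      induction B using Finsupp.induction_linear with
      | zero => simp
      | add A B hA hB => simp only [map_add, hA, hB]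
      | single p α =>
        have h1 : ∀ q : ℂ, mapVecPointed E (Finsupp.single q α) = Finsupp.single q (E α) :=
          fun q => by simp [mapVecPointed]
        simp only [difference, LinearMap.sub_apply, LinearMap.id_apply, translate_single, map_sub,
          h1]
    simp only [iterDifference, LinearMap.comp_apply, h, ih]

theorem mapVec_bound (r : ℕ) (E : V →L[ℝ] W) (A : ℂ →₀ V) :
    ‖(toChain r ∘ₗ mapVecPointed E) A‖ ≤ ‖E‖ * rNorm r A := by
  refine bound_of_diffElement _ (fun e he => ?_) (norm_nonneg E) A
  have h : mapVecPointed E e.chain = (⟨e.dirs, e.base, E e.vec⟩ : DiffElement W).chain := by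
    rw [DiffElement.chain, mapVecPointed_iterDifference]
    simp [DiffElement.chain, mapVecPointed]
  rw [LinearMap.comp_apply, norm_toChain, h]
  refine (rNorm_chain_le (r := r) ⟨e.dirs, e.base, E e.vec⟩ he).trans ?_
  have h1 : 0 ≤ (e.dirs.map (fun u => ‖u‖)).prod := List.prod_nonneg (by simp)
  calc _ ≤ (e.dirs.map (fun u => ‖u‖)).prod * (‖E‖ * ‖e.vec‖) :=
        mul_le_mul_of_nonneg_left (E.le_opNorm _) h1
    _ = _ := by rw [DiffElement.size]; ring

/-- The continuous extension of `(p; α) ↦ (p; E α)` to differential chains. -/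
def mapVec (r : ℕ) (E : V →L[ℝ] W) : Chain V r →L[ℝ] Chain W r :=
  extendChain (toChain r ∘ₗ mapVecPointed E) ⟨‖E‖, mapVec_bound r E⟩

theorem translate_translate (u v : ℂ) (A : ℂ →₀ V) :
    translate u (translate v A) = translate (u + v) A := by
  induction A using Finsupp.induction_linear with
  | zero => simp
  | add A B hA hB => simp only [map_add, hA, hB]
  | single p α => simp only [translate_single]; congr 1; ring

theorem translate_zero (A : ℂ →₀ V) : translate 0 A = A := by
  induction A using Finsupp.induction_linear with
  | zero => simp
  | add A B hA hB => simp only [map_add, hA, hB]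
  | single p α => simp [translate_single]

theorem translate_iterDifference (u : ℂ) (U : List ℂ) (A : ℂ →₀ V) :
    translate u (iterDifference U A) = iterDifference U (translate u A) := by
  induction U with
  | nil => rfl
  | cons w U ih =>
    simp only [iterDifference, LinearMap.comp_apply, difference, LinearMap.sub_apply, map_sub,
      LinearMap.id_apply, ← ih, translate_translate, add_comm u w]

theorem rNorm_translate_le (r : ℕ) (u : ℂ) (A : ℂ →₀ V) : rNorm r (translate u A) ≤ rNorm r A := by
  have := bound_of_diffElement (r := r) (C := 1) (toChain r ∘ₗ translate u (V := V))
    (fun e he => ?_) zero_le_one A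
  · simpa [norm_toChain] using this
  · have h : translate u e.chain = (⟨e.dirs, e.base + u, e.vec⟩ : DiffElement V).chain := by
      rw [DiffElement.chain, translate_iterDifference, translate_single]; rfl
    rw [LinearMap.comp_apply, norm_toChain, h, one_mul]
    exact rNorm_chain_le (r := r) ⟨e.dirs, e.base + u, e.vec⟩ he

theorem rNorm_difference_le (r : ℕ) (u : ℂ) (A : ℂ →₀ V) :
    rNorm (r + 1) (difference u A) ≤ ‖u‖ * rNorm r A := by
  have := bound_of_diffElement (r := r) (C := ‖u‖) (toChain (r + 1) ∘ₗ difference u (V := V))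
    (fun e he => ?_) (norm_nonneg u) A
  · simpa [norm_toChain] using this
  · have h : difference u e.chain = (⟨u :: e.dirs, e.base, e.vec⟩ : DiffElement V).chain := rfl
    rw [LinearMap.comp_apply, norm_toChain, h]
    refine (rNorm_chain_le (r := r + 1) ⟨u :: e.dirs, e.base, e.vec⟩ (Nat.succ_le_succ he)).trans (le_of_eq ?_)
    simp [DiffElement.size, mul_assoc]

/-- The difference quotient `Δ_{tv} (t⁻¹ A)` in the space of chains of order `r`. -/
def diffQuot (r : ℕ) (v : ℂ) (A : ℂ →₀ V) (t : ℝ) : Chain V r :=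
  toChain r (difference (t • v) (t⁻¹ • A))

theorem diffQuot_dist_le (s : ℕ) (v : ℂ) (A : ℂ →₀ V) {h k : ℝ} (hh : h ≠ 0) (hk : k ≠ 0) :
    ‖diffQuot (s + 2) v A h - diffQuot (s + 2) v A k‖ ≤
      (‖v‖ * (‖v‖ * rNorm s A)) * (|h| + |k|) := by
  set M : ℝ := ‖v‖ * (‖v‖ * rNorm s A) with hM
  have hM0 : 0 ≤ M := mul_nonneg (norm_nonneg _) (mul_nonneg (norm_nonneg _) (rNorm_nonneg _ _))
  let γ : ℝ → Chain V (s + 2) := fun t => toChain (s + 2) (translate (t • v) A)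
  have hlip : ∀ t t', ‖γ t - γ t'‖ ≤ (‖v‖ * rNorm (s + 1) A) * |t - t'| := by
    intro t t'
    have e : γ t - γ t' =
        toChain (s + 2) (difference ((t - t') • v) (translate (t' • v) A)) := by
      simp only [γ, difference, LinearMap.sub_apply, LinearMap.id_apply, translate_translate,
        ← map_sub]
      congr 4
      simp only [Complex.real_smul, Complex.ofReal_sub]; ring
    rw [e, norm_toChain]
    refine (rNorm_difference_le (s + 1) _ _).trans ?_
    rw [norm_smul, Real.norm_eq_abs]
    have := rNorm_translate_le (s + 1) (t' • v) A
    calc _ ≤ |t - t'| * ‖v‖ * rNorm (s + 1) A := by gcongr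
      _ = _ := by ring
  have hcont : Continuous γ := by
    have hC : 0 ≤ ‖v‖ * rNorm (s + 1) A := mul_nonneg (norm_nonneg _) (rNorm_nonneg _ _)
    exact (LipschitzWith.of_dist_le_mul (K := ⟨_, hC⟩) fun t t' => by
      rw [dist_eq_norm, Real.dist_eq]; exact hlip t t').continuous
  have hsec : ∀ a b : ℝ, ‖(γ (a + b) - γ b) - (γ a - γ 0)‖ ≤ M * |a| * |b| := by
    intro a b
    have e : (γ (a + b) - γ b) - (γ a - γ 0) =
        toChain (s + 2) (difference (a • v) (difference (b • v) A)) := by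
      simp only [γ, difference, LinearMap.sub_apply, LinearMap.id_apply, map_sub,
        translate_translate, zero_smul, translate_zero, add_smul]
    rw [e, norm_toChain]
    refine (rNorm_difference_le (s + 1) _ _).trans ?_
    have h1 := rNorm_difference_le s (b • v) A
    rw [norm_smul, Real.norm_eq_abs] at h1
    rw [norm_smul, Real.norm_eq_abs]
    calc _ ≤ |a| * ‖v‖ * (|b| * ‖v‖ * rNorm s A) := by gcongr
      _ = _ := by rw [hM]; ring
  have hq : ∀ t : ℝ, diffQuot (s + 2) v A t = t⁻¹ • (γ t - γ 0) := by
    intro t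
    simp only [diffQuot, γ, difference, map_smul, LinearMap.sub_apply, LinearMap.id_apply,
      map_sub, zero_smul, translate_zero]
  have hint : ∀ a b c : ℝ, IntervalIntegrable (fun x => γ (c + x)) volume a b := fun a b c =>
    (hcont.comp (continuous_const.add continuous_id)).intervalIntegrable a b
  have hint0 : ∀ a b : ℝ, IntervalIntegrable γ volume a b := fun a b =>
    hcont.intervalIntegrable a b
  let J : ℝ → ℝ → Chain V (s + 2) := fun a b => ∫ x in (0 : ℝ)..b, (γ (a + x) - γ x)
  have hJ : ∀ a b : ℝ, J a b = J b a := by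
    intro a b
    simp only [J]
    rw [intervalIntegral.integral_sub (hint _ _ _) (hint0 _ _),
      intervalIntegral.integral_sub (hint _ _ _) (hint0 _ _),
      intervalIntegral.integral_comp_add_left, intervalIntegral.integral_comp_add_left,
      add_zero, add_zero, add_comm b a,
      ← intervalIntegral.integral_interval_sub_left (hint0 0 (a + b)) (hint0 0 a),
      ← intervalIntegral.integral_interval_sub_left (hint0 0 (a + b)) (hint0 0 b)]
    abel
  have hJb : ∀ a b : ℝ, a ≠ 0 → b ≠ 0 →
      ‖(a * b)⁻¹ • J a b - a⁻¹ • (γ a - γ 0)‖ ≤ M * |b| := by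
    intro a b ha hb
    have e1 : J a b - b • (γ a - γ 0) =
        ∫ x in (0 : ℝ)..b, ((γ (a + x) - γ x) - (γ a - γ 0)) := by
      rw [intervalIntegral.integral_sub ((hint _ _ _).sub (hint0 _ _))
        intervalIntegrable_const, intervalIntegral.integral_const]
      simp [J]
    have e2 : ‖J a b - b • (γ a - γ 0)‖ ≤ M * |a| * |b| * |b| := by
      rw [e1]
      refine (intervalIntegral.norm_integral_le_of_norm_le_const (C := M * |a| * |b|)
        fun x hx => ?_).trans (by simp)
      refine (hsec a x).trans ?_
      have : |x| ≤ |b| := by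
        rcases Set.mem_uIoc.1 hx with h | h
        · rw [abs_of_pos h.1, abs_of_pos (h.1.trans_le h.2)]; exact h.2
        · rw [abs_of_nonpos h.2, abs_of_neg (h.1.trans_le h.2)]; linarith [h.1]
      gcongr
    have e3 : (a * b)⁻¹ • J a b - a⁻¹ • (γ a - γ 0) =
        (a * b)⁻¹ • (J a b - b • (γ a - γ 0)) := by
      rw [smul_sub _ (J a b), smul_smul]
      congr 2
      field_simp
    rw [e3, norm_smul, norm_inv, Real.norm_eq_abs, abs_mul]
    have ha' : 0 < |a| := abs_pos.2 ha
    have hb' : 0 < |b| := abs_pos.2 hb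
    rw [inv_mul_le_iff₀ (by positivity)]
    calc _ ≤ M * |a| * |b| * |b| := e2
      _ = _ := by ring
  have h1 := hJb h k hh hk
  have h2 := hJb k h hk hh
  rw [hJ k h, mul_comm k h] at h2
  rw [hq, hq]
  calc _ = ‖((h * k)⁻¹ • J h k - k⁻¹ • (γ k - γ 0)) -
        ((h * k)⁻¹ • J h k - h⁻¹ • (γ h - γ 0))‖ := by congr 1; abel
    _ ≤ M * |h| + M * |k| := (norm_sub_le _ _).trans (add_le_add h2 h1)
    _ = _ := by ring

theorem exists_tendsto_diffQuot (s : ℕ) (v : ℂ) (A : ℂ →₀ V) :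
    ∃ L, Tendsto (diffQuot (s + 2) v A) (𝓝[≠] (0 : ℝ)) (𝓝 L) := by
  rw [← cauchy_map_iff_exists_tendsto]
  set M : ℝ := ‖v‖ * (‖v‖ * rNorm s A) with hM
  have hM0 : 0 ≤ M := mul_nonneg (norm_nonneg _) (mul_nonneg (norm_nonneg _) (rNorm_nonneg _ _))
  refine Metric.cauchy_iff.2 ⟨inferInstance, fun ε hε => ?_⟩
  have hδ : 0 < ε / (2 * M + 1) := by positivity
  refine ⟨diffQuot (s + 2) v A '' ({x | |x| < ε / (2 * M + 1)} \ {0}),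
    image_mem_map (sdiff_mem_nhdsWithin_compl ?_ _), ?_⟩
  · have := Metric.ball_mem_nhds (0 : ℝ) hδ
    refine Filter.mem_of_superset this fun x hx => ?_
    simpa [Real.dist_eq] using hx
  · rintro _ ⟨h, ⟨hh, hh0⟩, rfl⟩ _ ⟨k, ⟨hk, hk0⟩, rfl⟩
    rw [dist_eq_norm]
    have hb := diffQuot_dist_le s v A (h := h) (k := k) hh0 hk0
    rw [← hM] at hb
    have hh' : |h| < ε / (2 * M + 1) := hh
    have hk' : |k| < ε / (2 * M + 1) := hk
    calc _ ≤ M * (|h| + |k|) := hb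
      _ ≤ M * (ε / (2 * M + 1) + ε / (2 * M + 1)) := by gcongr
      _ = ε * (2 * M / (2 * M + 1)) := by ring
      _ < ε * 1 := by
        gcongr
        rw [div_lt_one (by positivity)]; linarith
      _ = ε := mul_one ε

theorem tendsto_limUnder_diffQuot (s : ℕ) (v : ℂ) (A : ℂ →₀ V) :
    Tendsto (diffQuot (s + 2) v A) (𝓝[≠] (0 : ℝ))
      (𝓝 (limUnder (𝓝[≠] (0 : ℝ)) (diffQuot (s + 2) v A))) :=
  tendsto_nhds_limUnder (exists_tendsto_diffQuot s v A)

/-- The prederivative `P_v A = lim_{t → 0} Δ_{tv} (t⁻¹ A)` of a pointed chain. -/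
def prederivPointed (s : ℕ) (v : ℂ) : (ℂ →₀ V) →ₗ[ℝ] Chain V (s + 2) where
  toFun A := limUnder (𝓝[≠] (0 : ℝ)) (diffQuot (s + 2) v A)
  map_add' A B := by
    refine tendsto_nhds_unique (tendsto_limUnder_diffQuot s v (A + B)) ?_
    refine ((tendsto_limUnder_diffQuot s v A).add (tendsto_limUnder_diffQuot s v B)).congr ?_
    intro t
    simp only [diffQuot, smul_add, map_add]
  map_smul' c A := by
    refine tendsto_nhds_unique (tendsto_limUnder_diffQuot s v (c • A)) ?_
    refine ((tendsto_limUnder_diffQuot s v A).const_smul c).congr ?_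
    intro t
    simp only [diffQuot, map_smul, smul_comm c]

theorem prederivPointed_bound (s : ℕ) (v : ℂ) (A : ℂ →₀ V) :
    ‖prederivPointed s v A‖ ≤ ‖v‖ * rNorm (s + 1) A := by
  refine le_of_tendsto (tendsto_limUnder_diffQuot s v A).norm ?_
  filter_upwards [self_mem_nhdsWithin] with t ht
  have ht' : t ≠ 0 := ht
  rw [diffQuot, norm_toChain]
  refine (rNorm_difference_le (s + 1) _ _).trans ?_
  have h := rNorm_smul_le (s + 1) t⁻¹ A
  calc _ ≤ ‖t • v‖ * (|t⁻¹| * rNorm (s + 1) A) := by gcongr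
    _ = ‖v‖ * rNorm (s + 1) A := by
      rw [norm_smul, Real.norm_eq_abs, abs_inv]
      have : |t| ≠ 0 := abs_ne_zero.2 ht'
      field_simp

/-- The prederivative `P_v`, from chains of order `r = s + 1 ≥ 1` to chains of order `r + 1`. -/
def prederiv (s : ℕ) (v : ℂ) : Chain V (s + 1) →L[ℝ] Chain V (s + 2) :=
  extendChain (prederivPointed s v) ⟨‖v‖, prederivPointed_bound s v⟩

end Pointed

/-- Retraction of `1`-vectors to `0`-vectors: `E_v^†(w) = ⟨v, w⟩`. -/
def retractVec1 (v : ℂ) : Vec1 →L[ℝ] Vec0 := innerSL ℝ v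

/-- Retraction of `2`-vectors to `1`-vectors:
`E_v^†(c • e₁ ∧ e₂) = c • (⟨v, e₁⟩ e₂ - ⟨v, e₂⟩ e₁)`. -/
def retractVec2 (v : ℂ) : Vec2 →L[ℝ] Vec1 :=
  (ContinuousLinearMap.id ℝ ℝ).smulRight (inner ℝ v 1 • Complex.I - inner ℝ v Complex.I • (1 : ℂ))

/-- The boundary `∂ = P_{e₁} ∘ E_{e₁}^† + P_{e₂} ∘ E_{e₂}^†` of `1`-chains of order `s + 1`. -/
def boundary1 (s : ℕ) : Chain Vec1 (s + 1) →L[ℝ] Chain Vec0 (s + 2) :=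
  prederiv s 1 ∘L mapVec (s + 1) (retractVec1 1) +
    prederiv s Complex.I ∘L mapVec (s + 1) (retractVec1 Complex.I)

/-- The boundary `∂ = P_{e₁} ∘ E_{e₁}^† + P_{e₂} ∘ E_{e₂}^†` of `2`-chains of order `s + 1`. -/
def boundary2 (s : ℕ) : Chain Vec2 (s + 1) →L[ℝ] Chain Vec1 (s + 2) :=
  prederiv s 1 ∘L mapVec (s + 1) (retractVec2 1) +
    prederiv s Complex.I ∘L mapVec (s + 1) (retractVec2 Complex.I)

/-- `∂K = J` for a `2`-chain `K` of order `s` and a `1`-chain `J` of order `s + 1`.  The equation is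
read in the `1`-chains of order `s + 2`, so that it also makes sense for `s = 0`, where the boundary
operator of the chains of order `0` is only defined after passing to order `1`. -/
def IsBoundaryOf {s : ℕ} (J : Chain Vec1 (s + 1)) (K : Chain Vec2 s) : Prop :=
  boundary2 s (incl s K) = incl (s + 1) J

section Integral

variable {V : Type} [NormedAddCommGroup V] [NormedSpace ℝ V]

/-! ## Support and mass -/

/-- The closed set `X` supports `J`: for every non-empty open `W ⊇ X`, the chain `J` is a limit of
pointed chains in `W`. -/
def SupportedBy {r : ℕ} (J : Chain V r) (X : Set ℂ) : Prop :=
  IsClosed X ∧ ∀ W : Set ℂ, W.Nonempty → IsOpen W → X ⊆ W →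
    ∃ A : ℕ → ℂ →₀ V, (∀ i, ((A i).support : Set ℂ) ⊆ W) ∧
      Tendsto (fun i => toChain r (A i)) atTop (𝓝 J)

/-- The support of a chain: the intersection of all closed sets that support it. -/
def supp {r : ℕ} (J : Chain V r) : Set ℂ := ⋂₀ {X | SupportedBy J X}

/-- The mass of a chain: the infimum of `liminf ‖A_i‖_{B^0}` over all sequences of pointed chains
`A_i` that converge to it. -/
def mass {r : ℕ} (K : Chain V r) : ℝ≥0∞ :=
  ⨅ (A : ℕ → ℂ →₀ V) (_ : Tendsto (fun i => toChain r (A i)) atTop (𝓝 K)),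
    liminf (fun i => ENNReal.ofReal (rNorm 0 (A i))) atTop

/-! ## Forms and the Harrison integral

Forms are complex valued: `ω p` is a real-linear map from the `k`-vectors at `p` to `ℂ`.  Real and
imaginary parts of such a form are real forms, and it is integrated part by part. -/

/-- The value `ω(A) = ∑ ω_{p_i}(α_i)` of a form on a pointed chain `A = ∑ (p_i; α_i)`. -/
def evalForm (ω : ℂ → V →L[ℝ] ℂ) : (ℂ →₀ V) →ₗ[ℝ] ℂ :=
  Finsupp.lsum ℝ (fun p => (ω p).toLinearMap)

/-- `ω` belongs to the space `B^r` of forms: `‖ω‖_{B^r} < ∞`, i.e. `|ω(Δ_U^j (p; α))|` is bounded by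
a constant times `|Δ_U^j (p; α)|_j` for all `j ≤ r`. -/
def IsBForm (r : ℕ) (ω : ℂ → V →L[ℝ] ℂ) : Prop :=
  ∃ C : ℝ, ∀ e : DiffElement V, e.order ≤ r → ‖evalForm ω e.chain‖ ≤ C * e.size

theorem IsBForm.bound {r : ℕ} {ω : ℂ → V →L[ℝ] ℂ} (hω : IsBForm r ω) :
    ∃ C : ℝ, ∀ A, ‖evalForm ω A‖ ≤ C * rNorm r A := by
  obtain ⟨C, hC⟩ := hω
  refine ⟨max C 0, bound_of_diffElement _ (fun e he => ?_) (le_max_right C 0)⟩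
  exact (hC e he).trans (mul_le_mul_of_nonneg_right (le_max_left C 0) e.size_nonneg)

/-- The Harrison integral `∫_J ω` of a form `ω` in `B^r`, as a continuous linear functional of the
chain `J` of order `r`. -/
def pairing {r : ℕ} (ω : ℂ → V →L[ℝ] ℂ) (hω : IsBForm r ω) : Chain V r →L[ℝ] ℂ :=
  extendChain (evalForm ω) hω.bound

/-- The form `ω`, which matters only near the support of `J`, has Harrison integral `I` over `J`:
some form in `B^r` agrees with `ω` on a neighbourhood of `supp J`, and every such form has
integral `I` over `J`. -/
def HasHarrisonIntegral {r : ℕ} (J : Chain V r) (ω : ℂ → V →L[ℝ] ℂ) (I : ℂ) : Prop :=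
  (∃ η : ℂ → V →L[ℝ] ℂ, IsBForm r η ∧ ∀ᶠ p in 𝓝ˢ (supp J), η p = ω p) ∧
    ∀ (η : ℂ → V →L[ℝ] ℂ) (hη : IsBForm r η), (∀ᶠ p in 𝓝ˢ (supp J), η p = ω p) →
      pairing η hη J = I

/-- The Harrison integral of `ω` over `J` is defined. -/
def IsHarrisonIntegrable {r : ℕ} (J : Chain V r) (ω : ℂ → V →L[ℝ] ℂ) : Prop := ∃ I, HasHarrisonIntegral J ω I

open Classical in
/-- The Harrison integral `∫_J ω` of a form defined near the support of `J`
(and `0` if it is not defined). -/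
def harrisonIntegral {r : ℕ} (J : Chain V r) (ω : ℂ → V →L[ℝ] ℂ) : ℂ :=
  if h : IsHarrisonIntegrable J ω then h.choose else 0

end Integral

/-- The `1`-form `f(z) dz`. -/
def formDz (f : ℂ → ℂ) : ℂ → Vec1 →L[ℝ] ℂ := fun z => f z • ContinuousLinearMap.id ℝ ℂ

/-- The winding number `Ind_J(z) = (2πi)⁻¹ ∫_J dw / (w - z)`. -/
def windingNumber {r : ℕ} (J : Chain Vec1 r) (z : ℂ) : ℂ :=
  (2 * Real.pi * Complex.I)⁻¹ * harrisonIntegral J (formDz fun w => (w - z)⁻¹)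

/-- The `2`-chain of order `1` that represents an open set `D` of finite area: the integral over
`p ∈ D` of the simple pointed chains `(p; e₁ ∧ e₂)`, taken in the Banach space of chains. -/
def openSetChain (D : Set ℂ) : Chain Vec2 1 :=
  ∫ p in D, toChain 1 (Finsupp.single p (1 : Vec2))

end DiffChain

end

open DiffChain

/-! Only a smooth, compactly supported replacement `g` of `f` is ever integrated. Let `H` be the
union of `supp J` and the set where the index is nonzero: a closed subset of `U`, because the index
is locally constant off `supp J`. Around each pole `a` take a small open `B a` inside `D a` on which
the index is constant, and let `P` be `H` together with the closures of the `D a`, minus all the `B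
a`. This is a compact subset of `U` without poles, so some `g` equals `f` near `P`, and `dbar g`
vanishes on `P`.

Two formulas then reduce both sides to area integrals of `dbar g`. By Stokes (`pairing_boundary2`),
the integral of `f dz` over the boundary of `D a` is $\int_{D_a}\bar\partial
g=\int_{B_a}\bar\partial g$, writing $\bar\partial g$ for `dbar g`. By Cauchy–Pompeiu
(`integral_inv_mul_dbar`), `g` is near `supp J` a superposition of Cauchy kernels; integrating over
`J` under the integral sign gives $\int_J g\,dz=\int \bar\partial g(z)\,\mathrm{Ind}_J(z)$
(`pairing_formDz_eq_integral`). The last integrand lives on the sets `B a`, where the index is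
`windingNumber J a`.

The groundwork is a calculus of difference bounds (`BBound`), which puts smooth compactly supported
forms in every $\mathcal B^r$; the fact that a form vanishing near `supp J` has integral zero
(`pairing_eq_zero`), so that replacing `f` by `g` is legitimate; and the inclusion of the support of
$\partial\widetilde D$ in the frontier of $D$ (`supp_boundary2_openSetChain_subset`). -/

noncomputable section

namespace DiffChain

/-! ### Calculus of difference bounds for forms. -/

section FormDiff

variable {F G H : Type*} [NormedAddCommGroup F] [NormedSpace ℝ F]
  [NormedAddCommGroup G] [NormedSpace ℝ G] [NormedAddCommGroup H] [NormedSpace ℝ H]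

/-- The iterated difference of a function, dual to `iterDifference`. -/
def formDiff : List ℂ → (ℂ → F) → ℂ → F
  | [], ω => ω
  | u :: U, ω => formDiff U fun p => ω (p + u) - ω p

/-- The iterated differences of `ω` of order at most `r` are bounded with constant `C`. -/
def BBound (r : ℕ) (C : ℝ) (ω : ℂ → F) : Prop :=
  ∀ U : List ℂ, U.length ≤ r → ∀ p, ‖formDiff U ω p‖ ≤ C * (U.map fun u => ‖u‖).prod

theorem prod_norm_nonneg (U : List ℂ) : 0 ≤ (U.map fun u => ‖u‖).prod :=
  List.prod_nonneg (by simp)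

theorem BBound.nonneg {r : ℕ} {C : ℝ} {ω : ℂ → F} (h : BBound r C ω) : 0 ≤ C := by
  simpa [formDiff] using (norm_nonneg _).trans (h [] (by simp) 0)

theorem BBound.norm_le {r : ℕ} {C : ℝ} {ω : ℂ → F} (h : BBound r C ω) (p : ℂ) : ‖ω p‖ ≤ C := by
  simpa [formDiff] using h [] (by simp) p

theorem BBound.mono {r : ℕ} {C C' : ℝ} {ω : ℂ → F} (h : BBound r C ω) (hC : C ≤ C') :
    BBound r C' ω := fun U hU p =>
  (h U hU p).trans (mul_le_mul_of_nonneg_right hC (prod_norm_nonneg U))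

theorem BBound.of_succ {r : ℕ} {C : ℝ} {ω : ℂ → F} (h : BBound (r + 1) C ω) : BBound r C ω :=
  fun U hU p => h U (hU.trans r.le_succ) p

theorem BBound.difference {r : ℕ} {C : ℝ} {ω : ℂ → F} (h : BBound (r + 1) C ω) (u : ℂ) :
    BBound r (C * ‖u‖) fun p => ω (p + u) - ω p := fun U hU p => by
  simpa [formDiff, mul_assoc] using h (u :: U) (by simpa using hU) p

theorem BBound.succ {r : ℕ} {C : ℝ} {ω : ℂ → F} (h0 : ∀ p, ‖ω p‖ ≤ C)
    (h : ∀ u, BBound r (C * ‖u‖) fun p => ω (p + u) - ω p) : BBound (r + 1) C ω := by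
  rintro (_ | ⟨u, U⟩) hU p
  · simpa [formDiff] using h0 p
  · simpa [formDiff, mul_assoc] using h u U (by simpa using hU) p

theorem BBound.zero {C : ℝ} {ω : ℂ → F} (h0 : ∀ p, ‖ω p‖ ≤ C) : BBound 0 C ω := by
  intro U hU p
  obtain rfl : U = [] := by simpa using hU
  simpa [formDiff] using h0 p

theorem formDiff_add (U : List ℂ) (ω η : ℂ → F) :
    formDiff U (fun p => ω p + η p) = fun p => formDiff U ω p + formDiff U η p := by
  induction U generalizing ω η with
  | nil => rfl
  | cons u U ih =>
    simp only [formDiff]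
    rw [← ih]
    congr 1
    ext p
    abel

theorem BBound.add {r : ℕ} {C C' : ℝ} {ω η : ℂ → F} (h : BBound r C ω) (h' : BBound r C' η) :
    BBound r (C + C') fun p => ω p + η p := fun U hU p => by
  rw [formDiff_add, add_mul]
  exact (norm_add_le _ _).trans (add_le_add (h U hU p) (h' U hU p))

theorem formDiff_sub (U : List ℂ) (ω η : ℂ → F) :
    formDiff U (fun p => ω p - η p) = fun p => formDiff U ω p - formDiff U η p := by
  induction U generalizing ω η with
  | nil => rfl
  | cons u U ih =>
    simp only [formDiff]
    rw [← ih]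
    congr 1
    ext p
    abel

theorem BBound.sub {r : ℕ} {C C' : ℝ} {ω η : ℂ → F} (h : BBound r C ω) (h' : BBound r C' η) :
    BBound r (C + C') fun p => ω p - η p := fun U hU p => by
  rw [formDiff_sub, add_mul]
  exact (norm_sub_le _ _).trans (add_le_add (h U hU p) (h' U hU p))

theorem formDiff_translate (U : List ℂ) (ω : ℂ → F) (v : ℂ) :
    formDiff U (fun p => ω (p + v)) = fun p => formDiff U ω (p + v) := by
  induction U generalizing ω with
  | nil => rfl
  | cons u U ih =>
    simp only [formDiff]
    rw [← ih]
    congr 1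
    ext p
    rw [add_right_comm]

theorem BBound.translate {r : ℕ} {C : ℝ} {ω : ℂ → F} (h : BBound r C ω) (v : ℂ) :
    BBound r C fun p => ω (p + v) := fun U hU p => by
  rw [formDiff_translate]
  exact h U hU _

theorem formDiff_scale (U : List ℂ) (ω : ℂ → F) (t : ℂ) :
    formDiff U (fun p => ω (t * p)) = fun p => formDiff (U.map fun u => t * u) ω (t * p) := by
  induction U generalizing ω with
  | nil => rfl
  | cons u U ih =>
    simp only [formDiff, List.map_cons]
    rw [← ih]
    simp only [mul_add]

/-- Stretching a function shrinks its differences, so one constant serves cutoffs with arbitrarily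
large plateaus. -/
theorem BBound.scale {r : ℕ} {C : ℝ} {ω : ℂ → F} (h : BBound r C ω) {t : ℂ} (ht : ‖t‖ ≤ 1) :
    BBound r C fun p => ω (t * p) := fun U hU p => by
  rw [formDiff_scale]
  refine (h _ (by simpa using hU) _).trans (mul_le_mul_of_nonneg_left ?_ h.nonneg)
  clear hU
  induction U with
  | nil => simp
  | cons u U ih =>
    simp only [List.map_cons, List.prod_cons, norm_mul]
    exact mul_le_mul (mul_le_of_le_one_left (norm_nonneg _) ht) (by simpa using ih)
      (prod_norm_nonneg _) (norm_nonneg _)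

theorem formDiff_clm (U : List ℂ) (ω : ℂ → F) (L : F →L[ℝ] G) :
    formDiff U (fun p => L (ω p)) = fun p => L (formDiff U ω p) := by
  induction U generalizing ω with
  | nil => rfl
  | cons u U ih =>
    simp only [formDiff, ← ih, map_sub]

theorem BBound.clm {r : ℕ} {C : ℝ} {ω : ℂ → F} (h : BBound r C ω) (L : F →L[ℝ] G) :
    BBound r (‖L‖ * C) fun p => L (ω p) := fun U hU p => by
  rw [formDiff_clm, mul_assoc]
  exact (L.le_opNorm _).trans (mul_le_mul_of_nonneg_left (h U hU p) (norm_nonneg L))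

/-- The Leibniz rule for difference bounds. -/
theorem BBound.bilin (B : F →L[ℝ] G →L[ℝ] H) {r : ℕ} {C C' : ℝ} {φ : ℂ → F} {ω : ℂ → G}
    (h : BBound r C φ) (h' : BBound r C' ω) :
    BBound r (2 ^ r * (‖B‖ * C * C')) fun p => B (φ p) (ω p) := by
  have key : ∀ {C C' : ℝ} {φ : ℂ → F} {ω : ℂ → G} {r : ℕ}, BBound r C φ → BBound r C' ω →
      ∀ p, ‖B (φ p) (ω p)‖ ≤ ‖B‖ * C * C' := fun h h' p =>
    (B.le_opNorm₂ _ _).trans (mul_le_mul (mul_le_mul_of_nonneg_left (h.norm_le p) (norm_nonneg B))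
      (h'.norm_le p) (norm_nonneg _) (mul_nonneg (norm_nonneg B) h.nonneg))
  induction r generalizing C C' φ ω with
  | zero => exact BBound.zero fun p => by simpa using key h h' p
  | succ r ih =>
    have h0 : 0 ≤ ‖B‖ * C * C' := mul_nonneg (mul_nonneg (norm_nonneg B) h.nonneg) h'.nonneg
    refine BBound.succ (fun p => (key h h' p).trans ?_) fun u => ?_
    · exact le_mul_of_one_le_left h0 (one_le_pow₀ one_le_two)
    -- $\Delta_u B(\varphi,\omega)=B(\Delta_u\varphi,T_u\omega)+B(\varphi,\Delta_u\omega)$: each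
    -- summand gains a factor ‖u‖, and having two of them gives one factor 2 per order.
    · have h1 := (ih (h.difference u) (h'.translate u).of_succ).add
        (ih h.of_succ (h'.difference u))
      have e : (fun p => B (φ (p + u)) (ω (p + u)) - B (φ p) (ω p)) =
          fun p => B (φ (p + u) - φ p) (ω (p + u)) + B (φ p) (ω (p + u) - ω p) := by
        ext p
        simp
      rw [e]
      exact h1.mono (le_of_eq (by ring))

theorem formDiff_differentiable {φ : ℂ → F} (h : Differentiable ℝ φ) (U : List ℂ) (p : ℂ) :
    HasFDerivAt (formDiff U φ) (formDiff U (fderiv ℝ φ) p) p := by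
  induction U generalizing φ with
  | nil => exact (h p).hasFDerivAt
  | cons u U ih =>
    have hd : Differentiable ℝ fun p => φ (p + u) - φ p := by fun_prop
    have e : fderiv ℝ (fun p => φ (p + u) - φ p) = fun p => fderiv ℝ φ (p + u) - fderiv ℝ φ p := by
      ext1 p
      rw [fderiv_fun_sub (by fun_prop) (by fun_prop), fderiv_comp_add_right]
    simpa only [formDiff, e] using ih hd

/-- Mean value inequality for `formDiff U φ`, whose derivative is `formDiff U` of the derivative of
`φ`; the additional difference by `u` gains the factor ‖u‖. -/
theorem BBound.of_fderiv {r : ℕ} {C : ℝ} {φ : ℂ → F} (h0 : ∀ p, ‖φ p‖ ≤ C)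
    (hd : Differentiable ℝ φ) (h : BBound r C (fderiv ℝ φ)) : BBound (r + 1) C φ := by
  refine BBound.succ h0 fun u U hU p => ?_
  have e2 : formDiff U (fun p => φ (p + u) - φ p) p = formDiff U φ (p + u) - formDiff U φ p := by
    rw [formDiff_sub, formDiff_translate]
  rw [e2]
  have := Convex.norm_image_sub_le_of_norm_hasFDerivWithin_le (𝕜 := ℝ) (s := Set.univ)
    (f := formDiff U φ) (fun x _ => (formDiff_differentiable hd U x).hasFDerivWithinAt)
    (fun x _ => h U hU x) convex_univ (Set.mem_univ p) (Set.mem_univ (p + u))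
  refine this.trans (le_of_eq ?_)
  rw [add_sub_cancel_left]
  ring

end FormDiff

/-- `BBound.of_fderiv` climbs one order at a time. `F` is generalized in the induction because the
derivative takes values in another space. -/
theorem exists_bBound_of_contDiff {F : Type*} [NormedAddCommGroup F] [NormedSpace ℝ F]
    {φ : ℂ → F} (hφ : ContDiff ℝ (⊤ : ℕ∞) φ) (hc : HasCompactSupport φ) (r : ℕ) :
    ∃ C, BBound r C φ := by
  induction r generalizing F with
  | zero =>
    obtain ⟨C, hC⟩ := hc.exists_bound_of_continuous hφ.continuous
    exact ⟨C, BBound.zero hC⟩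
  | succ r ih =>
    obtain ⟨C, hC⟩ := hc.exists_bound_of_continuous hφ.continuous
    obtain ⟨C', hC'⟩ := ih (hφ.fderiv_right (m := (⊤ : ℕ∞)) le_rfl) (hc.fderiv ℝ)
    exact ⟨max C C', BBound.of_fderiv (fun p => (hC p).trans (le_max_left _ _))
      (hφ.differentiable (by simp)) (hC'.mono (le_max_right _ _))⟩

/-! ### The Harrison pairing and its norm bounds. -/

section Forms

variable {V W : Type} [NormedAddCommGroup V] [NormedSpace ℝ V]
  [NormedAddCommGroup W] [NormedSpace ℝ W]

theorem evalForm_single (ω : ℂ → V →L[ℝ] ℂ) (p : ℂ) (α : V) :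
    evalForm ω (Finsupp.single p α) = ω p α := by
  simp [evalForm]

theorem evalForm_difference (ω : ℂ → V →L[ℝ] ℂ) (u : ℂ) (A : ℂ →₀ V) :
    evalForm ω (difference u A) = evalForm (fun p => ω (p + u) - ω p) A := by
  induction A using Finsupp.induction_linear with
  | zero => simp
  | add A B hA hB => simp only [map_add, hA, hB]
  | single p α => simp [difference, translate_single, evalForm_single]

theorem evalForm_iterDifference (ω : ℂ → V →L[ℝ] ℂ) (U : List ℂ) (A : ℂ →₀ V) :
    evalForm ω (iterDifference U A) = evalForm (formDiff U ω) A := by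
  induction U generalizing ω with
  | nil => rfl
  | cons u U ih => simp only [iterDifference, LinearMap.comp_apply, evalForm_difference, ih, formDiff]

theorem evalForm_chain (ω : ℂ → V →L[ℝ] ℂ) (e : DiffElement V) :
    evalForm ω e.chain = formDiff e.dirs ω e.base e.vec := by
  rw [DiffElement.chain, evalForm_iterDifference, evalForm_single]

theorem BBound.evalForm_chain_le {r : ℕ} {C : ℝ} {ω : ℂ → V →L[ℝ] ℂ} (h : BBound r C ω)
    (e : DiffElement V) (he : e.order ≤ r) : ‖evalForm ω e.chain‖ ≤ C * e.size := by
  rw [evalForm_chain, DiffElement.size, ← mul_assoc]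
  exact ((formDiff e.dirs ω e.base).le_opNorm _).trans
    (mul_le_mul_of_nonneg_right (h e.dirs he e.base) (norm_nonneg _))

theorem BBound.isBForm {r : ℕ} {C : ℝ} {ω : ℂ → V →L[ℝ] ℂ} (h : BBound r C ω) : IsBForm r ω :=
  ⟨C, h.evalForm_chain_le⟩

theorem BBound.evalForm_le {r : ℕ} {C : ℝ} {ω : ℂ → V →L[ℝ] ℂ} (h : BBound r C ω)
    (A : ℂ →₀ V) : ‖evalForm ω A‖ ≤ C * rNorm r A :=
  bound_of_diffElement _ h.evalForm_chain_le h.nonneg A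

theorem IsBForm.exists_bBound {r : ℕ} {ω : ℂ → V →L[ℝ] ℂ} (h : IsBForm r ω) :
    ∃ C, BBound r C ω := by
  obtain ⟨C, hC⟩ := h
  -- `C` can be negative when `V` is trivial, and an operator norm bound must not be.
  refine ⟨max C 0, fun U hU p => ?_⟩
  refine ContinuousLinearMap.opNorm_le_bound _
    (mul_nonneg (le_max_right _ _) (prod_norm_nonneg U)) fun α => ?_
  have := hC ⟨U, p, α⟩ hU
  rw [evalForm_chain] at this
  refine this.trans ?_
  rw [mul_assoc]
  exact mul_le_mul_of_nonneg_right (le_max_left _ _) (DiffElement.size_nonneg ⟨U, p, α⟩)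

theorem isBForm_of_contDiff {ω : ℂ → V →L[ℝ] ℂ} (hω : ContDiff ℝ (⊤ : ℕ∞) ω)
    (hc : HasCompactSupport ω) (r : ℕ) : IsBForm r ω :=
  (exists_bBound_of_contDiff hω hc r).elim fun _ h => h.isBForm

theorem denseRange_toChain (r : ℕ) : DenseRange (toChain (V := V) r) := by
  have := Completion.denseRange_coe (α := Pointed V r)
  exact this

theorem exists_seq_tendsto {r : ℕ} (J : Chain V r) :
    ∃ A : ℕ → ℂ →₀ V, Tendsto (fun n => toChain r (A n)) atTop (𝓝 J) := by
  obtain ⟨x, hx, h⟩ := mem_closure_iff_seq_limit.1 (denseRange_toChain r J)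
  choose A hA using hx
  exact ⟨A, by simpa only [hA] using h⟩

theorem clm_ext_toChain {X : Type*} [NormedAddCommGroup X] [NormedSpace ℝ X] {r : ℕ}
    {S T : Chain V r →L[ℝ] X} (h : ∀ A, S (toChain r A) = T (toChain r A)) : S = T := by
  ext1 J
  exact congrFun ((denseRange_toChain r).equalizer S.continuous T.continuous (funext h)) J

theorem pairing_toChain {r : ℕ} {ω : ℂ → V →L[ℝ] ℂ} (hω : IsBForm r ω) (A : ℂ →₀ V) :
    pairing ω hω (toChain r A) = evalForm ω A :=
  extendChain_toChain _ _ A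

theorem BBound.pairing_le {r : ℕ} {C : ℝ} {ω : ℂ → V →L[ℝ] ℂ} (h : BBound r C ω)
    (hω : IsBForm r ω) (J : Chain V r) : ‖pairing ω hω J‖ ≤ C * ‖J‖ := by
  refine (denseRange_toChain r).induction_on J
    (isClosed_le (by fun_prop) (by fun_prop)) fun A => ?_
  rw [pairing_toChain, norm_toChain]
  exact h.evalForm_le A

theorem evalForm_congr {ω η : ℂ → V →L[ℝ] ℂ} {A : ℂ →₀ V} (h : ∀ p ∈ A.support, ω p = η p) :
    evalForm ω A = evalForm η A := by
  simp only [evalForm, Finsupp.lsum_apply, Finsupp.sum]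
  exact Finset.sum_congr rfl fun p hp => by simp [h p hp]

theorem evalForm_zero (A : ℂ →₀ V) : evalForm (fun _ => 0) A = 0 := by
  simp only [evalForm, Finsupp.lsum_apply, Finsupp.sum]
  exact Finset.sum_eq_zero fun p _ => rfl

theorem pairing_add {r : ℕ} {ω η : ℂ → V →L[ℝ] ℂ} (hω : IsBForm r ω) (hη : IsBForm r η)
    (h : IsBForm r fun p => ω p + η p) (J : Chain V r) :
    pairing _ h J = pairing ω hω J + pairing η hη J := by
  have : pairing _ h = pairing ω hω + pairing η hη := clm_ext_toChain fun A => by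
    simp only [add_apply, pairing_toChain]
    simp [evalForm, Finsupp.sum, Finset.sum_add_distrib]
  simp [this]

theorem pairing_sub {r : ℕ} {ω η : ℂ → V →L[ℝ] ℂ} (hω : IsBForm r ω) (hη : IsBForm r η)
    (h : IsBForm r fun p => ω p - η p) (J : Chain V r) :
    pairing _ h J = pairing ω hω J - pairing η hη J := by
  have : pairing _ h = pairing ω hω - pairing η hη := clm_ext_toChain fun A => by
    simp only [sub_apply, pairing_toChain]
    simp [evalForm, Finsupp.sum, Finset.sum_sub_distrib]
  simp [this]

end Forms


/-! ### Locality: the integral depends only on the form near the support. -/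

section Support

variable {V : Type} [NormedAddCommGroup V] [NormedSpace ℝ V]

theorem pairing_congr {r : ℕ} {ω η : ℂ → V →L[ℝ] ℂ} (hω : IsBForm r ω) (hη : IsBForm r η)
    (h : ω = η) (J : Chain V r) : pairing ω hω J = pairing η hη J := by
  subst h
  rfl

/-- The product of a form with a real function. -/
theorem BBound.smul {F : Type*} [NormedAddCommGroup F] [NormedSpace ℝ F] {r : ℕ} {C C' : ℝ}
    {φ : ℂ → ℝ} {ω : ℂ → F} (h : BBound r C φ) (h' : BBound r C' ω) :
    BBound r (2 ^ r * (‖ContinuousLinearMap.lsmul ℝ (E := F) ℝ‖ * C * C')) fun p => φ p • ω p :=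
  BBound.bilin (ContinuousLinearMap.lsmul ℝ ℝ) h h'

theorem support_fun_smul_subset (φ : ℂ → ℝ) (ω : ℂ → V →L[ℝ] ℂ) :
    Function.support (fun p => φ p • ω p) ⊆ Function.support φ := fun p hp h =>
  hp (by ext; simp [h])

theorem hasCompactSupport_fun_smul {φ : ℂ → ℝ} (hφ : HasCompactSupport φ) (ω : ℂ → V →L[ℝ] ℂ) :
    HasCompactSupport fun p => φ p • ω p :=
  hφ.mono (support_fun_smul_subset φ ω)

/-- The constant depends on the cutoff `φ` only through `C`; this uniformity is what
`pairing_eq_zero` needs. -/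
theorem BBound.sub_smul {F : Type*} [NormedAddCommGroup F] [NormedSpace ℝ F] {r : ℕ} {C C' : ℝ}
    {φ : ℂ → ℝ} {ω : ℂ → F} (h : BBound r C φ) (h' : BBound r C' ω) :
    BBound r (C' + 2 ^ r * (‖ContinuousLinearMap.lsmul ℝ (E := F) ℝ‖ * C * C'))
      fun p => ω p - φ p • ω p :=
  h'.sub (h.smul h')

theorem IsBForm.sub {r : ℕ} {ω η : ℂ → V →L[ℝ] ℂ} (hω : IsBForm r ω) (hη : IsBForm r η) :
    IsBForm r fun p => ω p - η p := by
  obtain ⟨C, h⟩ := hω.exists_bBound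
  obtain ⟨C', h'⟩ := hη.exists_bBound
  have := h.sub h'
  exact this.isBForm

theorem IsBForm.smul {r : ℕ} {φ : ℂ → ℝ} {ω : ℂ → V →L[ℝ] ℂ} {C : ℝ} (h : BBound r C φ)
    (hω : IsBForm r ω) : IsBForm r fun p => φ p • ω p := by
  obtain ⟨C', h'⟩ := hω.exists_bBound
  exact (h.smul h').isBForm

/-- The complement of `tsupport ω` is an open set around `X`, non-empty because `ω` has compact
support, so `J` is a limit of pointed chains on which `ω` vanishes. -/
theorem pairing_eq_zero_of_supportedBy {r : ℕ} {J : Chain V r} {X : Set ℂ}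
    (hX : SupportedBy J X) {ω : ℂ → V →L[ℝ] ℂ} (hω : IsBForm r ω) (hc : HasCompactSupport ω)
    (hd : X ⊆ (tsupport ω)ᶜ) : pairing ω hω J = 0 := by
  obtain ⟨A, hA, hlim⟩ := hX.2 _ (by
    rw [Set.nonempty_compl]
    exact hc.ne_univ) (isClosed_tsupport ω).isOpen_compl hd
  refine tendsto_nhds_unique (((pairing ω hω).continuous.tendsto J).comp hlim) ?_
  refine tendsto_const_nhds.congr fun i => ?_
  rw [Function.comp_apply, pairing_toChain, evalForm_congr (η := fun _ => 0)]
  · exact (evalForm_zero _).symm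
  · exact fun p hp => image_eq_zero_of_notMem_tsupport (hA i hp)

/-- Peeling in place of a partition of unity. The piece `φ x • ω` misses a supporting set and
integrates to zero; the remainder vanishes on the open set `N x`, so its closed support is covered
by the other sets. -/
theorem pairing_eq_zero_of_cover {r : ℕ} {J : Chain V r} (F : Finset ℂ) (N : ℂ → Set ℂ)
    (φ : ℂ → ℂ → ℝ) (hN : ∀ x ∈ F, IsOpen (N x))
    (hφ : ∀ x ∈ F, ContDiff ℝ (⊤ : ℕ∞) (φ x) ∧ HasCompactSupport (φ x) ∧
      (∀ p ∈ N x, φ x p = 1) ∧ ∃ X, SupportedBy J X ∧ X ⊆ (tsupport (φ x))ᶜ)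
    {ω : ℂ → V →L[ℝ] ℂ} (hω : IsBForm r ω) (hc : HasCompactSupport ω)
    (hcov : tsupport ω ⊆ ⋃ x ∈ F, N x) : pairing ω hω J = 0 := by
  classical
  induction F using Finset.induction_on generalizing ω with
  | empty =>
    have : ω = fun _ => 0 := by
      rw [← Pi.zero_def, ← tsupport_eq_empty_iff]
      simpa using hcov
    have h2 : pairing ω hω = 0 := clm_ext_toChain fun A => by
      rw [pairing_toChain, this, evalForm_zero]
      rfl
    simp [h2]
  | insert x F _ ih =>
    obtain ⟨hs, hφc, h1, X, hX, hXd⟩ := hφ x (by simp)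
    obtain ⟨C, hC⟩ := exists_bBound_of_contDiff hs hφc r
    have hB := IsBForm.smul hC hω
    have hD : IsBForm r fun p => ω p - φ x p • ω p := hω.sub hB
    have hBc : HasCompactSupport fun p => φ x p • ω p := hasCompactSupport_fun_smul hφc _
    have e1 : pairing _ hB J = 0 := pairing_eq_zero_of_supportedBy hX hB hBc
      (hXd.trans (Set.compl_subset_compl.2 (closure_mono (support_fun_smul_subset _ _))))
    have hDs : Function.support (fun p => ω p - φ x p • ω p) ⊆ tsupport ω := fun p hp => by
      by_contra h
      exact hp (by ext; simp [image_eq_zero_of_notMem_tsupport h])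
    have e2 : pairing _ hD J = 0 := by
      refine ih (fun y hy => hN y (by simp [hy])) (fun y hy => hφ y (by simp [hy])) hD
        (HasCompactSupport.mono' hc hDs) fun p hp => ?_
      have h2 := hcov (closure_minimal hDs (isClosed_tsupport ω) hp)
      simp only [Set.mem_iUnion, Finset.mem_insert, exists_prop] at h2 ⊢
      obtain ⟨y, rfl | hy, hpy⟩ := h2
      · exfalso
        obtain ⟨q, hq, hq'⟩ := mem_closure_iff.1 hp _ (hN y (by simp)) hpy
        exact hq' (by simp [h1 q hq])
      · exact ⟨y, hy, hpy⟩
    rw [pairing_sub hω hB, e1, sub_zero] at e2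
    exact e2

theorem isClosed_supp {r : ℕ} (J : Chain V r) : IsClosed (supp J) :=
  isClosed_sInter fun _ hX => hX.1

/-- `supp J` is an intersection of supporting sets and is not assumed to support `J` itself. Each
point of `tsupport ω` avoids some supporting set and has a bump function avoiding the same set; by
compactness finitely many suffice. -/
theorem pairing_eq_zero_of_hasCompactSupport {r : ℕ} {J : Chain V r} {ω : ℂ → V →L[ℝ] ℂ}
    (hω : IsBForm r ω) (hc : HasCompactSupport ω) (hd : Disjoint (tsupport ω) (supp J)) :
    pairing ω hω J = 0 := by
  have h1 : ∀ x ∈ tsupport ω, ∃ N : Set ℂ, ∃ φ : ℂ → ℝ, x ∈ N ∧ IsOpen N ∧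
      ContDiff ℝ (⊤ : ℕ∞) φ ∧ HasCompactSupport φ ∧
      (∀ p ∈ N, φ p = 1) ∧ ∃ X, SupportedBy J X ∧ X ⊆ (tsupport φ)ᶜ := by
    intro x hx
    have hxs : x ∉ supp J := fun h => hd.le_bot ⟨hx, h⟩
    simp only [supp, Set.mem_sInter, Set.mem_ofPred_eq, not_forall] at hxs
    obtain ⟨X, hX, hxX⟩ := hxs
    obtain ⟨ε, hε, hb⟩ := Metric.isOpen_iff.1 hX.1.isOpen_compl x hxX
    let b : ContDiffBump x := ⟨ε / 4, ε / 2, by positivity, by linarith⟩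
    refine ⟨Metric.ball x (ε / 4), b, Metric.mem_ball_self (by positivity), Metric.isOpen_ball,
      b.contDiff, b.hasCompactSupport,
      fun p hp => b.one_of_mem_closedBall (Metric.ball_subset_closedBall hp), X, hX, ?_⟩
    rw [Set.subset_compl_comm, b.tsupport_eq]
    exact (Metric.closedBall_subset_ball (half_lt_self hε)).trans hb
  choose! N φ hxN hN hφ using h1
  obtain ⟨F, hF, hcov⟩ := hc.isCompact.elim_nhds_subcover N
    fun x hx => (hN x hx).mem_nhds (hxN x hx)
  exact pairing_eq_zero_of_cover F N φ (fun x hx => hN x (hF x hx)) (fun x hx => hφ x (hF x hx))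
    hω hc hcov

/-- A form that vanishes near the support of a chain has integral zero. -/
theorem pairing_eq_zero {r : ℕ} {J : Chain V r} {ω : ℂ → V →L[ℝ] ℂ} (hω : IsBForm r ω)
    (h : ∀ᶠ p in 𝓝ˢ (supp J), ω p = 0) : pairing ω hω J = 0 := by
  obtain ⟨N, hNo, hsN, hN⟩ := eventually_nhdsSet_iff_exists.1 h
  -- The support of `ω` need not be compact. All cutoffs below are rescalings of this one bump, so
  -- they share the constant `C`.
  let b : ContDiffBump (0 : ℂ) := ⟨1, 2, one_pos, one_lt_two⟩
  obtain ⟨C, hC⟩ := exists_bBound_of_contDiff (b.contDiff (n := (⊤ : ℕ∞))) b.hasCompactSupport r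
  obtain ⟨M, hM⟩ := hω.exists_bBound
  obtain ⟨C', hC'⟩ : ∃ C' : ℝ, ∀ φ : ℂ → ℝ, BBound r C φ → BBound r C' fun p => ω p - φ p • ω p :=
    ⟨_, fun φ hφ => hφ.sub_smul hM⟩
  -- For a cutoff `φ` equal to 1 on the points of `A`, the form `φ • ω` kills `J` by the compact
  -- case and `ω - φ • ω` kills `A`. Since `C'` does not depend on `A`, letting `A` tend to `J`
  -- finishes.
  have key : ∀ A : ℂ →₀ V, ‖pairing ω hω J‖ ≤ C' * ‖J - toChain r A‖ := by
    intro A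
    obtain ⟨R, hR0, hR⟩ : ∃ R : ℝ, 1 ≤ R ∧ ∀ p ∈ A.support, ‖p‖ ≤ R := by
      obtain ⟨R, hR⟩ := (A.support.finite_toSet.image fun p => ‖p‖).bddAbove
      exact ⟨max 1 R, le_max_left _ _, fun p hp =>
        (hR (Set.mem_image_of_mem _ hp)).trans (le_max_right _ _)⟩
    have hRpos : 0 < R := zero_lt_one.trans_le hR0
    have hR' : (R : ℂ) ≠ 0 := by exact_mod_cast hRpos.ne'
    have hnorm : ‖(R : ℂ)⁻¹‖ = R⁻¹ := by
      rw [norm_inv, Complex.norm_real, Real.norm_eq_abs, abs_of_pos hRpos]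
    obtain ⟨φ, hφC, hφc, hφ1⟩ : ∃ φ : ℂ → ℝ, BBound r C φ ∧ HasCompactSupport φ ∧
        ∀ p ∈ A.support, φ p = 1 := by
      refine ⟨_, hC.scale (t := (R : ℂ)⁻¹) (hnorm.trans_le (inv_le_one_of_one_le₀ hR0)),
        b.hasCompactSupport.comp_homeomorph (Homeomorph.mulLeft₀ _ (inv_ne_zero hR')),
        fun p hp => b.one_of_mem_closedBall ?_⟩
      rw [mem_closedBall_zero_iff, norm_mul, hnorm]
      exact inv_mul_le_one_of_le₀ (hR p hp) hRpos.le
    have hB := IsBForm.smul hφC hω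
    have hD := hC' φ hφC
    have e1 : pairing _ hB J = 0 := by
      refine pairing_eq_zero_of_hasCompactSupport _ (hasCompactSupport_fun_smul hφc _) ?_
      rw [Set.disjoint_left]
      intro p hp hpJ
      obtain ⟨q, hq, hq'⟩ := mem_closure_iff.1 hp _ hNo (hsN hpJ)
      exact hq' (by ext; simp [hN q hq])
    have e2 : pairing _ hD.isBForm (toChain r A) = 0 := by
      rw [pairing_toChain, evalForm_congr (η := fun _ => 0), evalForm_zero]
      intro p hp
      rw [hφ1 p hp, one_smul, sub_self]
    have e3 : pairing ω hω J = pairing _ hD.isBForm (J - toChain r A) := by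
      rw [map_sub, e2, pairing_sub hω hB, e1, sub_zero, sub_zero]
    rw [e3]
    exact hD.pairing_le _ _
  obtain ⟨A, hA⟩ := exists_seq_tendsto J
  have hl : Tendsto (fun n => C' * ‖J - toChain r (A n)‖) atTop (𝓝 (C' * ‖J - J‖)) :=
    (tendsto_const_nhds.sub hA).norm.const_mul C'
  have := ge_of_tendsto' hl fun n => key (A n)
  simpa using this

theorem hasHarrisonIntegral_pairing {r : ℕ} {J : Chain V r} {ω η : ℂ → V →L[ℝ] ℂ}
    (hη : IsBForm r η) (h : ∀ᶠ p in 𝓝ˢ (supp J), η p = ω p) :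
    HasHarrisonIntegral J ω (pairing η hη J) := by
  refine ⟨⟨η, hη, h⟩, fun θ hθ h' => ?_⟩
  have := pairing_eq_zero (J := J) (hθ.sub hη) (by
    filter_upwards [h, h'] with p h1 h2
    rw [h1, h2, sub_self])
  rwa [pairing_sub hθ hη, sub_eq_zero] at this

theorem HasHarrisonIntegral.harrisonIntegral_eq {r : ℕ} {J : Chain V r} {ω : ℂ → V →L[ℝ] ℂ}
    {I : ℂ} (h : HasHarrisonIntegral J ω I) : harrisonIntegral J ω = I := by
  have h1 : IsHarrisonIntegrable J ω := ⟨I, h⟩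
  rw [harrisonIntegral, dif_pos h1]
  obtain ⟨η, hη, he⟩ := h.1
  rw [← h.2 η hη he, ← h1.choose_spec.2 η hη he]

theorem harrisonIntegral_eq_pairing {r : ℕ} {J : Chain V r} {ω η : ℂ → V →L[ℝ] ℂ}
    (hη : IsBForm r η) (h : ∀ᶠ p in 𝓝ˢ (supp J), η p = ω p) :
    harrisonIntegral J ω = pairing η hη J :=
  (hasHarrisonIntegral_pairing hη h).harrisonIntegral_eq

end Support


/-! ### Duality between operators on chains and operators on forms. -/

section Operators

variable {V W : Type} [NormedAddCommGroup V] [NormedSpace ℝ V]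
  [NormedAddCommGroup W] [NormedSpace ℝ W]

theorem IsBForm.comp {r : ℕ} {ω : ℂ → W →L[ℝ] ℂ} (hω : IsBForm r ω) (E : V →L[ℝ] W) :
    IsBForm r fun p => (ω p).comp E := by
  obtain ⟨C, h⟩ := hω.exists_bBound
  have := h.clm ((ContinuousLinearMap.compL ℝ V W ℂ).flip E)
  exact this.isBForm

theorem IsBForm.add {r : ℕ} {ω η : ℂ → V →L[ℝ] ℂ} (hω : IsBForm r ω) (hη : IsBForm r η) :
    IsBForm r fun p => ω p + η p := by
  obtain ⟨C, h⟩ := hω.exists_bBound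
  obtain ⟨C', h'⟩ := hη.exists_bBound
  have := h.add h'
  exact this.isBForm

theorem mapVec_toChain (r : ℕ) (E : V →L[ℝ] W) (A : ℂ →₀ V) :
    mapVec r E (toChain r A) = toChain r (mapVecPointed E A) :=
  extendChain_toChain _ _ A

theorem mapVecPointed_single (E : V →L[ℝ] W) (p : ℂ) (α : V) :
    mapVecPointed E (Finsupp.single p α) = Finsupp.single p (E α) := by
  simp [mapVecPointed]

theorem pairing_mapVec {r : ℕ} {ω : ℂ → W →L[ℝ] ℂ} (hω : IsBForm r ω) (E : V →L[ℝ] W)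
    (J : Chain V r) : pairing ω hω (mapVec r E J) = pairing _ (hω.comp E) J := by
  have : (pairing ω hω).comp (mapVec r E) = pairing _ (hω.comp E) := clm_ext_toChain fun A => by
    rw [ContinuousLinearMap.comp_apply, mapVec_toChain, pairing_toChain, pairing_toChain]
    induction A using Finsupp.induction_linear with
    | zero => simp
    | add A B hA hB => simp only [map_add, hA, hB]
    | single p α => simp only [mapVecPointed_single, evalForm_single, ContinuousLinearMap.comp_apply]
  exact DFunLike.congr_fun this J

theorem prederiv_toChain (s : ℕ) (v : ℂ) (A : ℂ →₀ V) :
    prederiv s v (toChain (s + 1) A) = prederivPointed s v A :=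
  extendChain_toChain _ _ A

theorem tendsto_diffQuot (s : ℕ) (v : ℂ) (A : ℂ →₀ V) :
    Tendsto (diffQuot (s + 2) v A) (𝓝[≠] (0 : ℝ)) (𝓝 (prederiv s v (toChain (s + 1) A))) := by
  rw [prederiv_toChain]
  exact tendsto_limUnder_diffQuot s v A

/-- The prederivative is dual to the directional derivative of forms. -/
theorem pairing_prederiv {s : ℕ} {v : ℂ} {ω ω' : ℂ → V →L[ℝ] ℂ} (hω : IsBForm (s + 2) ω)
    (hω' : IsBForm (s + 1) ω') (h : ∀ p, HasLineDerivAt ℝ ω (ω' p) p v) (J : Chain V (s + 1)) :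
    pairing ω hω (prederiv s v J) = pairing ω' hω' J := by
  have : (pairing ω hω).comp (prederiv s v) = pairing ω' hω' := clm_ext_toChain fun A => by
    rw [ContinuousLinearMap.comp_apply, pairing_toChain]
    refine tendsto_nhds_unique
      (((pairing ω hω).continuous.tendsto _).comp (tendsto_diffQuot s v A)) ?_
    have e : (pairing ω hω) ∘ diffQuot (s + 2) v A = fun t : ℝ =>
        t⁻¹ • evalForm (fun p => ω (p + t • v) - ω p) A := by
      ext1 t
      rw [Function.comp_apply, diffQuot, pairing_toChain, map_smul, map_smul, evalForm_difference]
    rw [e]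
    clear e
    induction A using Finsupp.induction_linear with
    | zero => simp
    | add A B hA hB =>
      simp only [map_add, smul_add]
      exact hA.add hB
    | single p α =>
      simp only [evalForm_single]
      have h1 := (h p).tendsto_slope_zero
      have h2 := ((ContinuousLinearMap.apply ℝ ℂ α).continuous.tendsto (ω' p)).comp h1
      refine h2.congr fun t => ?_
      simp
  exact DFunLike.congr_fun this J

/-- The difference quotient operator on chains. -/
def chainDiffQuot (s : ℕ) (v : ℂ) (t : ℝ) : Chain V s →L[ℝ] Chain V (s + 1) :=
  extendChain (toChain (s + 1) ∘ₗ difference (t • v) ∘ₗ (t⁻¹ • LinearMap.id))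
    ⟨‖t • v‖ * |t⁻¹|, fun A => by
      simp only [LinearMap.comp_apply, norm_toChain, mul_assoc]
      exact (rNorm_difference_le s _ _).trans
        (mul_le_mul_of_nonneg_left (rNorm_smul_le s t⁻¹ A) (norm_nonneg _))⟩

theorem chainDiffQuot_toChain (s : ℕ) (v : ℂ) (t : ℝ) (A : ℂ →₀ V) :
    chainDiffQuot s v t (toChain s A) = diffQuot (s + 1) v A t :=
  extendChain_toChain _ _ A

theorem norm_chainDiffQuot_le (s : ℕ) (v : ℂ) {t : ℝ} (ht : t ≠ 0) (K : Chain V s) :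
    ‖chainDiffQuot s v t K‖ ≤ ‖v‖ * ‖K‖ := by
  refine (denseRange_toChain s).induction_on K
    (isClosed_le (by fun_prop) (by fun_prop)) fun A => ?_
  rw [chainDiffQuot_toChain, diffQuot, norm_toChain, norm_toChain]
  have h := rNorm_smul_le s t⁻¹ A
  refine (rNorm_difference_le s _ _).trans ?_
  calc _ ≤ ‖t • v‖ * (|t⁻¹| * rNorm s A) := by gcongr
    _ = ‖v‖ * rNorm s A := by
      rw [norm_smul, Real.norm_eq_abs, abs_inv]
      have : |t| ≠ 0 := abs_ne_zero.2 ht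
      field_simp

/-- The quotients are bounded by ‖v‖ uniformly in `t`, so convergence on the dense pointed chains
extends to all chains. -/
theorem tendsto_chainDiffQuot (s : ℕ) (v : ℂ) (K : Chain V (s + 1)) :
    Tendsto (fun t => chainDiffQuot (s + 1) v t K) (𝓝[≠] (0 : ℝ)) (𝓝 (prederiv s v K)) := by
  rw [Metric.tendsto_nhds]
  intro ε hε
  obtain ⟨A, hA⟩ := exists_seq_tendsto K
  have hl : Tendsto (fun n => ‖v‖ * ‖K - toChain (s + 1) (A n)‖ +
      ‖prederiv s v (toChain (s + 1) (A n)) - prederiv s v K‖) atTop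
      (𝓝 (‖v‖ * ‖K - K‖ + ‖prederiv s v K - prederiv s v K‖)) :=
    ((tendsto_const_nhds.sub hA).norm.const_mul _).add
      (((((prederiv s v).continuous.tendsto K).comp hA).sub_const _).norm)
  simp only [sub_self, norm_zero, mul_zero, add_zero] at hl
  obtain ⟨n, hn⟩ := (hl.eventually_lt_const (half_pos hε)).exists
  filter_upwards [Metric.tendsto_nhds.1 (tendsto_diffQuot s v (A n)) _ (half_pos hε),
    self_mem_nhdsWithin] with t ht ht0
  rw [dist_eq_norm] at ht ⊢
  have h1 := norm_chainDiffQuot_le (s + 1) v ht0 (K - toChain (s + 1) (A n))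
  rw [map_sub, chainDiffQuot_toChain] at h1
  calc _ = ‖(chainDiffQuot (s + 1) v t K - diffQuot (s + 2) v (A n) t) +
        (prederiv s v (toChain (s + 1) (A n)) - prederiv s v K) +
        (diffQuot (s + 2) v (A n) t - prederiv s v (toChain (s + 1) (A n)))‖ := by
        congr 1; abel
    _ ≤ _ := norm_add₃_le
    _ < ε := by linarith

/-! ### The support of the boundary of an open set. -/

/-- The pointed chains in a set, as a subspace of the chains. -/
def chainsIn (V : Type) [NormedAddCommGroup V] [NormedSpace ℝ V] (r : ℕ) (W : Set ℂ) : Submodule ℝ (Chain V r) :=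
  (Finsupp.supported V ℝ W).map (toChain r)

theorem toChain_single_mem_chainsIn {r : ℕ} {W : Set ℂ} {p : ℂ} (hp : p ∈ W) (α : V) :
    toChain r (Finsupp.single p α) ∈ chainsIn V r W :=
  Submodule.mem_map_of_mem (Finsupp.single_mem_supported ℝ α hp)

theorem supportedBy_of_mem_closure {r : ℕ} {J : Chain V r} {X : Set ℂ} (hX : IsClosed X)
    (h : ∀ W : Set ℂ, IsOpen W → X ⊆ W → J ∈ closure (chainsIn V r W : Set (Chain V r))) :
    SupportedBy J X := by
  refine ⟨hX, fun W _ hW hXW => ?_⟩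
  obtain ⟨x, hx, hl⟩ := mem_closure_iff_seq_limit.1 (h W hW hXW)
  choose A hA hAx using fun n => (Submodule.mem_map.1 (hx n))
  exact ⟨A, fun i => (Finsupp.mem_supported ℝ _).1 (hA i), by simpa only [hAx] using hl⟩

theorem SupportedBy.add {r : ℕ} {J J' : Chain V r} {X : Set ℂ} (h : SupportedBy J X)
    (h' : SupportedBy J' X) : SupportedBy (J + J') X := by
  classical
  refine ⟨h.1, fun W hne hW hXW => ?_⟩
  obtain ⟨A, hA, hl⟩ := h.2 W hne hW hXW
  obtain ⟨B, hB, hl'⟩ := h'.2 W hne hW hXW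
  refine ⟨fun i => A i + B i, fun i p hp => ?_, by simpa only [map_add] using hl.add hl'⟩
  rcases Finset.mem_union.1 (Finsupp.support_add hp) with h | h
  exacts [hA i h, hB i h]

theorem norm_toChain_single_le (r : ℕ) (p : ℂ) (α : V) :
    ‖toChain r (Finsupp.single p α)‖ ≤ ‖α‖ := by
  have := rNorm_chain_le (r := r) (⟨[], p, α⟩ : DiffElement V) (by simp [DiffElement.order])
  simpa [norm_toChain, DiffElement.chain, iterDifference, DiffElement.size] using this

theorem continuous_toChain_single (r : ℕ) (α : V) :
    Continuous fun p => toChain (r + 1) (Finsupp.single p α) := by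
  refine (LipschitzWith.of_dist_le_mul (K := ‖α‖₊) fun p q => ?_).continuous
  have h := rNorm_difference_le r (p - q) (Finsupp.single q α)
  have h2 := norm_toChain_single_le r q α
  rw [norm_toChain] at h2
  rw [dist_eq_norm, ← map_sub, norm_toChain, dist_eq_norm, coe_nnnorm]
  have e : difference (p - q) (Finsupp.single q α) = Finsupp.single p α - Finsupp.single q α := by
    simp [difference, translate_single]
  rw [e] at h
  exact h.trans ((mul_le_mul_of_nonneg_left h2 (norm_nonneg _)).trans (le_of_eq (mul_comm _ _)))

theorem integrableOn_toChain_single (r : ℕ) (α : V) {D : Set ℂ} (hD : volume D ≠ ⊤) :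
    IntegrableOn (fun p => toChain (r + 1) (Finsupp.single p α)) D := by
  refine Measure.integrableOn_of_bounded (M := ‖α‖) hD
    (continuous_toChain_single r α).aestronglyMeasurable ?_
  exact Eventually.of_forall fun p => norm_toChain_single_le _ p α

/-- The quotient map by the closure of `M` kills `f` pointwise, hence kills its integral. For
non-integrable `f` the integral is 0 by convention. -/
theorem integral_mem_closure {X E : Type*} [MeasurableSpace X] {μ : Measure X}
    [NormedAddCommGroup E] [NormedSpace ℝ E] [CompleteSpace E] (M : Submodule ℝ E)
    {f : X → E} (hf : ∀ x, f x ∈ M) : ∫ x, f x ∂μ ∈ closure (M : Set E) := by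
  by_cases hi : Integrable f μ
  · have : IsClosed (M.topologicalClosure : Set E) := M.isClosed_topologicalClosure
    have h := ContinuousLinearMap.integral_comp_comm M.topologicalClosure.mkQL hi
    have h0 : ∀ x, M.topologicalClosure.mkQL (f x) = 0 := fun x => by
      rw [Submodule.mkQL_apply, Submodule.mkQ_apply, Submodule.Quotient.mk_eq_zero]
      exact M.le_topologicalClosure (hf x)
    simp only [h0, integral_zero] at h
    rw [eq_comm, Submodule.mkQL_apply, Submodule.mkQ_apply, Submodule.Quotient.mk_eq_zero] at h
    exact h
  · rw [integral_undef hi]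
    exact subset_closure M.zero_mem

theorem exists_frontier_mem_segment {D : Set ℂ} (hD : IsOpen D) {p q : ℂ} (hp : p ∈ D)
    (hq : q ∉ D) : ∃ z ∈ segment ℝ p q, z ∈ frontier D := by
  by_contra! h
  have := (convex_segment p q).isPreconnected.subset_of_closure_inter_subset hD
    ⟨p, left_mem_segment ℝ p q, hp⟩ (fun z hz => by
      by_contra hzD
      exact h z hz.2 (by rw [hD.frontier_eq]; exact ⟨hz.1, hzD⟩))
  exact hq (this (right_mem_segment ℝ p q))

theorem dist_le_of_mem_segment {p q z : ℂ} (hz : z ∈ segment ℝ p q) :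
    dist z p ≤ dist p q ∧ dist z q ≤ dist p q := by
  have := dist_add_dist_of_mem_segment hz
  rw [dist_comm p z] at this
  constructor <;> linarith [dist_nonneg (x := z) (y := p), dist_nonneg (x := z) (y := q)]

/-- The prederivative of the chain of a bounded open set is supported by its frontier. -/
theorem supportedBy_prederiv_integral {D : Set ℂ} (hD : IsOpen D) (hb : Bornology.IsBounded D)
    (v : ℂ) (α : V) :
    SupportedBy (prederiv 0 v (∫ p in D, toChain 1 (Finsupp.single p α))) (frontier D) := by
  refine supportedBy_of_mem_closure isClosed_frontier fun W hW hDW => ?_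
  have hcpt : IsCompact (frontier D) :=
    Metric.isCompact_of_isClosed_isBounded isClosed_frontier
      (hb.closure.subset frontier_subset_closure)
  obtain ⟨ε, hε, hεW⟩ := hcpt.exists_thickening_subset_open hW hDW
  have hvol : volume D ≠ ⊤ := hb.measure_lt_top.ne
  -- It suffices that the difference quotients with small `t` lie in the closure of the chains in
  -- `W`.
  refine isClosed_closure.mem_of_tendsto (tendsto_chainDiffQuot 0 v _) ?_
  have hsmall : ∀ᶠ t : ℝ in 𝓝[≠] 0, ‖t • v‖ < ε := by
    have : Tendsto (fun t : ℝ => ‖t • v‖) (𝓝[≠] 0) (𝓝 ‖(0 : ℝ) • v‖) :=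
      tendsto_nhdsWithin_of_tendsto_nhds (Continuous.tendsto (by fun_prop) 0)
    exact this.eventually_lt_const (by simpa using hε)
  filter_upwards [hsmall] with t ht
  set w := t • v
  set c : ℂ → Chain V 2 := fun p => toChain 2 (Finsupp.single p α)
  have hcD : IntegrableOn c D := integrableOn_toChain_single 1 α hvol
  -- `F` is the chain density of the translate `D + w`. It cancels against that of `D` except at
  -- points `p` where exactly one of `p`, `p - w` lies in `D`; the segment between them, shorter
  -- than `ε`, then meets the frontier, so `p` lies in `W`.
  set F : ℂ → Chain V 2 := Set.indicator ((fun p => p - w) ⁻¹' D) c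
  have hF : ∀ p, F (p + w) = D.indicator (fun p => c (p + w)) p := fun p => by
    have h1 : p + w ∈ (fun p => p - w) ⁻¹' D ↔ p ∈ D := by simp
    by_cases hp : p ∈ D
    · rw [Set.indicator_of_mem hp]
      exact Set.indicator_of_mem (h1.2 hp) c
    · rw [Set.indicator_of_notMem hp]
      exact Set.indicator_of_notMem (mt h1.1 hp) c
  have hD' : MeasurableSet ((fun p : ℂ => p - w) ⁻¹' D) :=
    (hD.preimage (by fun_prop)).measurableSet
  have hcD2 : IntegrableOn (fun p => c (p + w)) D := by
    refine Measure.integrableOn_of_bounded (M := ‖α‖) hvol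
      ((continuous_toChain_single 1 α).comp (by fun_prop)).aestronglyMeasurable
      (Eventually.of_forall fun p => norm_toChain_single_le _ _ α)
  have hFi : Integrable F := by
    have : Integrable fun p => F (p + w) := by
      simp only [hF]
      exact (integrable_indicator_iff hD.measurableSet).2 hcD2
    simpa using this.comp_add_right (-w)
  have e : chainDiffQuot 1 v t (∫ p in D, toChain 1 (Finsupp.single p α)) =
      t⁻¹ • ∫ p, (F p - D.indicator c p) := by
    rw [← ContinuousLinearMap.integral_comp_comm _ (integrableOn_toChain_single 0 α hvol)]
    have h1 : ∀ p, chainDiffQuot 1 v t (toChain 1 (Finsupp.single p α)) =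
        t⁻¹ • (c (p + w) - c p) := fun p => by
      rw [chainDiffQuot_toChain, diffQuot, map_smul, map_smul]
      simp only [difference, LinearMap.sub_apply, translate_single, LinearMap.id_apply, map_sub, c,
        w]
    simp only [h1]
    rw [integral_smul, integral_sub hcD2 hcD, integral_sub hFi
      ((integrable_indicator_iff hD.measurableSet).2 hcD), integral_indicator hD.measurableSet,
      ← integral_add_right_eq_self F w]
    simp only [hF]
    rw [integral_indicator hD.measurableSet]
  rw [e]
  refine (Submodule.smul_mem (chainsIn V 2 W).topologicalClosure t⁻¹ ?_ :)
  refine integral_mem_closure _ fun p => ?_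
  simp only [F, Set.indicator, Set.mem_preimage]
  have hin : ∀ z ∈ segment ℝ p (p - w), z ∈ frontier D → p ∈ W := fun z hz hzD => by
    refine hεW (Metric.mem_thickening_iff.2 ⟨z, hzD, ?_⟩)
    rw [dist_comm]
    refine (dist_le_of_mem_segment hz).1.trans_lt ?_
    rwa [dist_eq_norm, sub_sub_cancel]
  by_cases h1 : p - w ∈ D <;> by_cases h2 : p ∈ D
  · simp [h1, h2]
  · obtain ⟨z, hz, hzD⟩ := exists_frontier_mem_segment hD h1 h2
    rw [segment_symm] at hz
    simpa [h1, h2] using toChain_single_mem_chainsIn (r := 2) (hin z hz hzD) α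
  · obtain ⟨z, hz, hzD⟩ := exists_frontier_mem_segment hD h2 h1
    simpa [h1, h2] using toChain_single_mem_chainsIn (r := 2) (hin z hz hzD) α
  · simp [h1, h2]

theorem mapVec_integral (r : ℕ) (E : V →L[ℝ] W) (α : V) {D : Set ℂ} (hD : volume D ≠ ⊤) :
    mapVec (r + 1) E (∫ p in D, toChain (r + 1) (Finsupp.single p α)) =
      ∫ p in D, toChain (r + 1) (Finsupp.single p (E α)) := by
  rw [← ContinuousLinearMap.integral_comp_comm _ (integrableOn_toChain_single r α hD)]
  simp only [mapVec_toChain, mapVecPointed_single]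

theorem supp_boundary2_openSetChain_subset {D : Set ℂ} (hD : IsOpen D)
    (hb : Bornology.IsBounded D) : supp (boundary2 0 (openSetChain D)) ⊆ frontier D := by
  refine Set.sInter_subset_of_mem ?_
  have hvol : volume D ≠ ⊤ := hb.measure_lt_top.ne
  have := (supportedBy_prederiv_integral hD hb 1 (retractVec2 1 1)).add
    (supportedBy_prederiv_integral hD hb Complex.I (retractVec2 Complex.I 1))
  rw [← mapVec_integral 0 _ _ hvol, ← mapVec_integral 0 _ _ hvol] at this
  exact this

theorem pairing_openSetChain {ω : ℂ → Vec2 →L[ℝ] ℂ} (hω : IsBForm 1 ω) {D : Set ℂ}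
    (hD : volume D ≠ ⊤) : pairing ω hω (openSetChain D) = ∫ p in D, ω p 1 := by
  rw [openSetChain, ← ContinuousLinearMap.integral_comp_comm _ (integrableOn_toChain_single 0 _ hD)]
  simp only [pairing_toChain, evalForm_single]

end Operators

/-! ### Stokes' theorem for forms `g dz` and for exact forms. -/

section Stokes

/-- `2 i ∂g/∂z̄ = i ∂g/∂x - ∂g/∂y`. -/
def dbar (g : ℂ → ℂ) (z : ℂ) : ℂ := Complex.I * fderiv ℝ g z 1 - fderiv ℝ g z Complex.I

/-- The `2`-form `h e₁^* ∧ e₂^*`. -/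
def form2 (h : ℂ → ℂ) : ℂ → Vec2 →L[ℝ] ℂ := fun z =>
  (ContinuousLinearMap.id ℝ ℝ).smulRight (h z)

variable {g : ℂ → ℂ}

theorem hasLineDerivAt_clm {E : Type*} [NormedAddCommGroup E] [NormedSpace ℝ E] (L : ℂ →L[ℝ] E)
    (hg : Differentiable ℝ g) (p v : ℂ) :
    HasLineDerivAt ℝ (fun z => L (g z)) (L (fderiv ℝ g p v)) p v :=
  (L.hasFDerivAt.comp p (hg p).hasFDerivAt).hasLineDerivAt v

theorem contDiff_fderiv_apply (hg : ContDiff ℝ (⊤ : ℕ∞) g) (v : ℂ) :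
    ContDiff ℝ (⊤ : ℕ∞) fun p => fderiv ℝ g p v :=
  (hg.fderiv_right (m := (⊤ : ℕ∞)) le_rfl).clm_apply contDiff_const

theorem contDiff_dbar (hg : ContDiff ℝ (⊤ : ℕ∞) g) : ContDiff ℝ (⊤ : ℕ∞) (dbar g) :=
  (contDiff_const.mul (contDiff_fderiv_apply hg 1)).sub (contDiff_fderiv_apply hg Complex.I)

theorem hasCompactSupport_dbar (hc : HasCompactSupport g) : HasCompactSupport (dbar g) :=
  (hc.fderiv ℝ).mono fun p hp h => hp (by simp [dbar, h])

theorem isBForm_clm {V : Type} [NormedAddCommGroup V] [NormedSpace ℝ V]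
    (L : ℂ →L[ℝ] V →L[ℝ] ℂ) (hg : ContDiff ℝ (⊤ : ℕ∞) g) (hc : HasCompactSupport g) (r : ℕ) :
    IsBForm r fun p => L (g p) := by
  obtain ⟨C, h⟩ := exists_bBound_of_contDiff hg hc r
  have := h.clm L
  exact this.isBForm

/-- The linear map `c ↦ c dz`. -/
def dzL : ℂ →L[ℝ] Vec1 →L[ℝ] ℂ := ContinuousLinearMap.mul ℝ ℂ

theorem formDz_eq (g : ℂ → ℂ) : formDz g = fun z => dzL (g z) := by
  ext z v
  simp [formDz, dzL]

theorem form2_eq (h : ℂ → ℂ) :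
    form2 h = fun z => ContinuousLinearMap.smulRightL ℝ ℝ ℂ (ContinuousLinearMap.id ℝ ℝ) (h z) := by
  ext z
  simp [form2]

theorem isBForm_formDz (hg : ContDiff ℝ (⊤ : ℕ∞) g) (hc : HasCompactSupport g) (r : ℕ) :
    IsBForm r (formDz g) := by
  rw [formDz_eq]
  exact isBForm_clm dzL hg hc r

theorem isBForm_form2 (hg : ContDiff ℝ (⊤ : ℕ∞) g) (hc : HasCompactSupport g) (r : ℕ) :
    IsBForm r (form2 g) := by
  rw [form2_eq]
  exact isBForm_clm _ hg hc r

theorem hasCompactSupport_fderiv_apply (hc : HasCompactSupport g) (v : ℂ) :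
    HasCompactSupport fun p => fderiv ℝ g p v :=
  (hc.fderiv ℝ).mono fun p hp h => hp (by simp [h])

theorem hasLineDerivAt_formDz (hg : ContDiff ℝ (⊤ : ℕ∞) g) (v p : ℂ) :
    HasLineDerivAt ℝ (formDz g) (formDz (fun p => fderiv ℝ g p v) p) p v := by
  rw [formDz_eq, formDz_eq]
  exact hasLineDerivAt_clm dzL (hg.differentiable (by simp)) p v

theorem hasLineDerivAt_form2 (hg : ContDiff ℝ (⊤ : ℕ∞) g) (v p : ℂ) :
    HasLineDerivAt ℝ (form2 g) (form2 (fun p => fderiv ℝ g p v) p) p v := by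
  rw [form2_eq, form2_eq]
  exact hasLineDerivAt_clm _ (hg.differentiable (by simp)) p v

/-- Stokes' theorem `∫_{∂K} g dz = ∫_K 2 i ∂g/∂z̄ dx ∧ dy`. -/
theorem pairing_boundary2 (hg : ContDiff ℝ (⊤ : ℕ∞) g) (hc : HasCompactSupport g) {s : ℕ}
    (K : Chain Vec2 (s + 1)) :
    pairing (formDz g) (isBForm_formDz hg hc (s + 2)) (boundary2 s K) =
      pairing (form2 (dbar g))
        (isBForm_form2 (contDiff_dbar hg) (hasCompactSupport_dbar hc) (s + 1)) K := by
  have hB : ∀ v : ℂ, IsBForm (s + 1) (formDz fun p => fderiv ℝ g p v) := fun v =>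
    isBForm_formDz (contDiff_fderiv_apply hg v) (hasCompactSupport_fderiv_apply hc v) _
  rw [boundary2, add_apply, ContinuousLinearMap.comp_apply,
    ContinuousLinearMap.comp_apply, map_add,
    pairing_prederiv _ (hB 1) (hasLineDerivAt_formDz hg 1),
    pairing_prederiv _ (hB Complex.I) (hasLineDerivAt_formDz hg Complex.I),
    pairing_mapVec, pairing_mapVec,
    ← pairing_add _ _ (((hB 1).comp _).add ((hB Complex.I).comp _))]
  -- The retractions along `1` and `I` send $e_1\wedge e_2$ to `I` and `-1`, so `dz` produces
  -- $i\,g_x-g_y$.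
  refine pairing_congr _ _ (funext fun p => ?_) K
  ext
  simp [formDz, form2, dbar, retractVec2]
  ring

/-- The fundamental theorem `∫_{∂J} g = ∫_J dg` for closed `J`. -/
theorem pairing_fderiv_eq_zero (hg : ContDiff ℝ (⊤ : ℕ∞) g) (hc : HasCompactSupport g) {s : ℕ}
    {J : Chain Vec1 (s + 1)} (hJ : boundary1 s J = 0) (h : IsBForm (s + 1) (fderiv ℝ g)) :
    pairing (fderiv ℝ g) h J = 0 := by
  -- `Vec0` and `Vec2` are both ℝ, so `form2` serves here as the 0-form given by a function.
  have hB : ∀ v : ℂ, IsBForm (s + 1) (form2 fun p => fderiv ℝ g p v) := fun v =>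
    isBForm_form2 (contDiff_fderiv_apply hg v) (hasCompactSupport_fderiv_apply hc v) _
  have h0 : pairing (form2 g) (isBForm_form2 hg hc (s + 2)) (boundary1 s J) = 0 := by
    rw [hJ, map_zero]
  rw [boundary1, add_apply, ContinuousLinearMap.comp_apply,
    ContinuousLinearMap.comp_apply, map_add,
    pairing_prederiv _ (hB 1) (hasLineDerivAt_form2 hg 1),
    pairing_prederiv _ (hB Complex.I) (hasLineDerivAt_form2 hg Complex.I),
    pairing_mapVec, pairing_mapVec,
    ← pairing_add _ _ (((hB 1).comp _).add ((hB Complex.I).comp _))] at h0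
  rw [← h0]
  refine pairing_congr _ _ (funext fun p => ?_) J
  ext v
  have : v = v.re • (1 : ℂ) + v.im • Complex.I := by simp
  conv_lhs => rw [this, map_add, map_smul, map_smul]
  simp [form2, retractVec1]

end Stokes


/-! ### The Cauchy–Pompeiu formula. -/

section Pompeiu

open Complex

/-- The primitive is $-i\log(R+iy)$ in the right half-plane; the endpoints are conjugate with
arguments $\pm\pi/4$. -/
theorem integral_inv_add_mul_I {R : ℝ} (hR : 0 < R) :
    ∫ y : ℝ in -R..R, ((R : ℂ) + y * I)⁻¹ = Real.pi / 2 := by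
  have hd : ∀ y : ℝ, HasDerivAt (fun y : ℝ => -I * log ((R : ℂ) + y * I)) ((R : ℂ) + y * I)⁻¹ y := by
    intro y
    have h1 : HasDerivAt (fun y : ℝ => (R : ℂ) + y * I) I y := by
      simpa using ((hasDerivAt_id y).ofReal_comp.mul_const I).const_add (R : ℂ)
    have h2 := (h1.clog_real (by left; simpa using hR)).const_mul (-I)
    refine h2.congr_deriv ?_
    rw [← mul_div_assoc, neg_mul, I_mul_I, neg_neg, one_div]
  rw [intervalIntegral.integral_eq_sub_of_hasDerivAt (fun y _ => hd y)]
  · have harg : ((R : ℂ) + (R : ℝ) * I).arg = Real.pi / 4 := by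
      have := arg_mul_cos_add_sin_mul_I (r := R * √2) (θ := Real.pi / 4) (by positivity)
        ⟨by linarith [Real.pi_pos], by linarith [Real.pi_pos]⟩
      rw [← this]
      congr 1
      have h2 : ((√2 : ℝ) : ℂ) ^ 2 = 2 := by
        rw [← ofReal_pow, Real.sq_sqrt (by norm_num)]
        norm_num
      rw [← ofReal_cos, ← ofReal_sin, Real.cos_pi_div_four, Real.sin_pi_div_four]
      push_cast
      linear_combination (-(R : ℂ) * (1 + I) / 2) * h2
    have hconj : (R : ℂ) + (-R : ℝ) * I = (starRingEnd ℂ) ((R : ℂ) + (R : ℝ) * I) := by simp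
    rw [hconj, log_conj _ (by rw [harg]; linarith [Real.pi_pos]), ← mul_sub, sub_conj, log_im, harg]
    push_cast
    linear_combination (-(Real.pi / 2 : ℂ)) * I_mul_I
  · refine ContinuousOn.intervalIntegrable (ContinuousOn.inv₀ (by fun_prop) fun y _ h => ?_)
    have := congrArg re h
    simp at this
    exact hR.ne' this

/-- The other three sides reduce to the right one by the quarter turn $x-iR=-i(R+ix)$ and by
$x\mapsto -x$. -/
theorem integral_boundary_square_inv {R : ℝ} (hR : 0 < R) :
    (∫ x : ℝ in -R..R, ((x : ℂ) + (-R : ℝ) * I)⁻¹) - (∫ x : ℝ in -R..R, ((x : ℂ) + R * I)⁻¹) +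
      I • (∫ y : ℝ in -R..R, ((R : ℂ) + y * I)⁻¹) -
      I • (∫ y : ℝ in -R..R, (((-R : ℝ) : ℂ) + y * I)⁻¹) = 2 * Real.pi * I := by
  have h0 := integral_inv_add_mul_I hR
  have h1 : ∫ x : ℝ in -R..R, ((x : ℂ) + (-R : ℝ) * I)⁻¹ = I * (Real.pi / 2) := by
    rw [← h0, ← intervalIntegral.integral_const_mul]
    congr 1
    ext x
    rw [← inv_inv I, ← mul_inv, inv_inv, inv_I]
    congr 1
    push_cast
    ring_nf
    simp
  have h2 : ∫ x : ℝ in -R..R, ((x : ℂ) + R * I)⁻¹ = -I * (Real.pi / 2) := by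
    have := intervalIntegral.integral_comp_neg (a := -R) (b := R) (fun x : ℝ => ((x : ℂ) + R * I)⁻¹)
    rw [neg_neg] at this
    rw [← this, neg_mul, ← h1, ← intervalIntegral.integral_neg]
    congr 1
    ext x
    rw [← inv_neg]
    congr 1
    push_cast
    ring
  have h3 : ∫ y : ℝ in -R..R, (((-R : ℝ) : ℂ) + y * I)⁻¹ = -(Real.pi / 2) := by
    have := intervalIntegral.integral_comp_neg (a := -R) (b := R)
      (fun x : ℝ => (((-R : ℝ) : ℂ) + x * I)⁻¹)
    rw [neg_neg] at this
    rw [← this, ← h0, ← intervalIntegral.integral_neg]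
    congr 1
    ext x
    rw [← inv_neg]
    congr 1
    push_cast
    ring
  rw [h0, h1, h2, h3]
  simp only [smul_eq_mul]
  ring

theorem integral_eq_iterated {h : ℂ → ℂ} (hi : Integrable h) :
    ∫ z, h z = ∫ x : ℝ, ∫ y : ℝ, h (x + y * I) := by
  have hm := volume_preserving_equiv_real_prod.symm
  rw [← hm.integral_comp (MeasurableEquiv.measurableEmbedding _), Measure.volume_eq_prod,
    integral_prod _ (by
      rw [← Measure.volume_eq_prod]
      exact (hm.integrable_comp_emb (MeasurableEquiv.measurableEmbedding _)).2 hi)]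
  simp only [measurableEquivRealProd_symm_apply, mk_eq_add_mul_I]

theorem dbar_eq_zero {g : ℂ → ℂ} {z : ℂ} (h : DifferentiableAt ℂ g z) : dbar g z = 0 := by
  have h1 := h.hasDerivAt.complexToReal_fderiv
  rw [dbar, h1.fderiv]
  simp [mul_comm]

/-- The Cauchy–Pompeiu formula at a point near which the function is holomorphic. -/
theorem integral_inv_mul_dbar_zero {g : ℂ → ℂ} (hg : ContDiff ℝ (⊤ : ℕ∞) g)
    (hc : HasCompactSupport g) (h0 : ∀ᶠ z in 𝓝 (0 : ℂ), DifferentiableAt ℂ g z) :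
    ∫ z, z⁻¹ * dbar g z = -(2 * Real.pi * I * g 0) := by
  set h : ℂ → ℂ := fun z => z⁻¹ * dbar g z with hh
  have hcont : Continuous h := by
    rw [continuous_iff_continuousAt]
    intro z
    rcases eq_or_ne z 0 with rfl | hz
    -- Holomorphy near 0 makes `dbar g` vanish there, which removes the singularity of the kernel.
    · refine continuousAt_const.congr (f := fun _ => (0 : ℂ)) ?_
      filter_upwards [h0] with z hz
      simp [hh, dbar_eq_zero hz]
    · exact (continuousAt_inv₀ hz).mul (contDiff_dbar hg).continuous.continuousAt
  have hhc : HasCompactSupport h := (hasCompactSupport_dbar hc).mul_left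
  have hi : Integrable h := hcont.integrable_of_hasCompactSupport hhc
  obtain ⟨R, hR, hRg, hRh⟩ : ∃ R : ℝ, 0 < R ∧ (∀ z, R ≤ ‖z‖ → g z = 0) ∧
      ∀ z, R ≤ ‖z‖ → h z = 0 := by
    obtain ⟨R1, hR1⟩ := hc.isCompact.isBounded.exists_norm_le
    obtain ⟨R2, hR2⟩ := hhc.isCompact.isBounded.exists_norm_le
    refine ⟨max 0 (max R1 R2) + 1, by positivity, fun z hz => ?_, fun z hz => ?_⟩
    · by_contra hne
      have := hR1 z (subset_tsupport g hne)
      linarith [le_max_right 0 (max R1 R2), le_max_left R1 R2]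
    · by_contra hne
      have := hR2 z (subset_tsupport h hne)
      linarith [le_max_right 0 (max R1 R2), le_max_right R1 R2]
  have hre : ∀ x y : ℝ, |x| ≤ ‖(x : ℂ) + y * I‖ := fun x y => by
    simpa using abs_re_le_norm ((x : ℂ) + y * I)
  have him : ∀ x y : ℝ, |y| ≤ ‖(x : ℂ) + y * I‖ := fun x y => by
    simpa using abs_im_le_norm ((x : ℂ) + y * I)
  have hIoc : ∀ x : ℝ, x ∉ Set.Ioc (-R) R → R ≤ |x| := fun x hx => by
    by_contra! hlt
    exact hx ⟨(abs_lt.1 hlt).1, (abs_lt.1 hlt).2.le⟩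
  have hrhs : ∫ x : ℝ in -R..R, ∫ y : ℝ in -R..R, h (x + y * I) = ∫ z, h z := by
    have h1 : ∀ x : ℝ, ∫ y : ℝ in -R..R, h (x + y * I) = ∫ y : ℝ, h (x + y * I) := fun x => by
      refine intervalIntegral.integral_eq_integral_of_support_subset fun y hy => ?_
      by_contra hn
      exact hy (hRh _ ((hIoc y hn).trans (him x y)))
    simp only [h1]
    rw [integral_eq_iterated hi]
    refine intervalIntegral.integral_eq_integral_of_support_subset fun x hx => ?_
    by_contra hn
    refine hx ?_
    simp [hRh _ ((hIoc x hn).trans (hre x _))]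
  -- $F(z)=(g(z)-g(0))/z$ is continuous at 0, satisfies `dbar F = h` off 0, and equals $-g(0)/z$ on
  -- the boundary of the square of half-side `R`. Green's theorem with exceptional set `{0}` then
  -- gives the formula.
  set F : ℂ → ℂ := dslope g 0 with hF
  have hFR : ∀ z : ℂ, R ≤ ‖z‖ → F z = -g 0 * z⁻¹ := fun z hz => by
    have hz0 : z ≠ 0 := norm_pos_iff.1 (hR.trans_le hz)
    rw [hF, dslope_of_ne _ hz0, slope_def_field, hRg z hz]
    simp [div_eq_mul_inv]
  let F' : ℂ → ℂ →L[ℝ] ℂ := fun z =>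
    (g z - g 0) • ((ContinuousLinearMap.toSpanSingleton ℂ (-(z ^ 2)⁻¹)).restrictScalars ℝ) +
      z⁻¹ • fderiv ℝ g z
  have hF' : ∀ z, I • F' z 1 - F' z I = h z := fun z => by
    simp [F', hh, dbar]
    ring
  have hFd : ∀ z, z ≠ 0 → HasFDerivAt F (F' z) z := fun z hz => by
    have h1 : HasFDerivAt (fun z : ℂ => z⁻¹)
        ((ContinuousLinearMap.toSpanSingleton ℂ (-(z ^ 2)⁻¹)).restrictScalars ℝ) z :=
      (hasDerivAt_inv hz).hasFDerivAt.restrictScalars ℝ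
    have h2 : HasFDerivAt (fun z => g z - g 0) (fderiv ℝ g z) z :=
      ((hg.differentiable (by simp)) z).hasFDerivAt.sub_const _
    refine (h2.mul h1).congr_of_eventuallyEq ?_
    filter_upwards [isOpen_ne.mem_nhds hz] with y hy
    rw [hF, dslope_of_ne _ hy, slope_def_field, sub_zero, div_eq_mul_inv]
    rfl
  have hFc : Continuous F := by
    rw [continuous_iff_continuousAt]
    intro z
    rcases eq_or_ne z 0 with rfl | hz
    · exact continuousAt_dslope_same.2 h0.self_of_nhds
    · exact (hFd z hz).continuousAt
  have key := integral_boundary_rect_of_hasFDerivAt_real_off_countable F F' ⟨-R, -R⟩ ⟨R, R⟩ {0}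
    (Set.countable_singleton 0) hFc.continuousOn (fun z hz => hFd z hz.2)
    (by simpa only [hF'] using hi.integrableOn)
  simp only [hF'] at key
  rw [hrhs] at key
  rw [← key]
  have e1 : ∀ x : ℝ, F ((x : ℂ) + (-R : ℝ) * I) = -g 0 * ((x : ℂ) + (-R : ℝ) * I)⁻¹ := fun x =>
    hFR _ (by simpa [abs_of_pos hR] using him x (-R))
  have e2 : ∀ x : ℝ, F ((x : ℂ) + R * I) = -g 0 * ((x : ℂ) + R * I)⁻¹ := fun x =>
    hFR _ (by simpa [abs_of_pos hR] using him x R)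
  have e3 : ∀ y : ℝ, F ((R : ℂ) + y * I) = -g 0 * ((R : ℂ) + y * I)⁻¹ := fun y =>
    hFR _ (by simpa [abs_of_pos hR] using hre R y)
  have e4 : ∀ y : ℝ, F (((-R : ℝ) : ℂ) + y * I) = -g 0 * (((-R : ℝ) : ℂ) + y * I)⁻¹ := fun y =>
    hFR _ (by simpa [abs_of_pos hR] using hre (-R) y)
  simp only [e1, e2, e3, e4, intervalIntegral.integral_const_mul]
  rw [← integral_boundary_square_inv hR]
  simp only [smul_eq_mul]
  ring

theorem integral_inv_mul_dbar {g : ℂ → ℂ} (hg : ContDiff ℝ (⊤ : ℕ∞) g)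
    (hc : HasCompactSupport g) {w : ℂ} (hw : ∀ᶠ z in 𝓝 w, DifferentiableAt ℂ g z) :
    ∫ z, dbar g z * (w - z)⁻¹ = 2 * Real.pi * I * g w := by
  have h1 := integral_inv_mul_dbar_zero (g := fun z => g (z + w)) (by fun_prop)
    (hc.comp_homeomorph (Homeomorph.addRight w)) (by
      have : Tendsto (fun z : ℂ => z + w) (𝓝 0) (𝓝 w) := by
        simpa using (continuous_add_const w).tendsto 0
      filter_upwards [this.eventually hw] with z hz
      exact hz.comp z (by fun_prop))
  have h2 : dbar (fun z => g (z + w)) = fun z => dbar g (z + w) := by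
    ext z
    simp only [dbar, fderiv_comp_add_right]
  rw [h2] at h1
  have h3 := integral_add_right_eq_self (μ := volume) (fun z => (z - w)⁻¹ * dbar g z) w
  simp only [add_sub_cancel_right] at h3
  rw [h3, zero_add] at h1
  rw [← neg_eq_iff_eq_neg] at h1
  rw [← h1, ← integral_neg]
  congr 1
  ext z
  rw [← neg_sub z w, inv_neg]
  ring

end Pompeiu


/-! ### Cauchy kernels and winding numbers. -/

section Winding

open Complex
open scoped Manifold

/-- Multiply `f` by a smooth cutoff that is 1 near `P` and vanishes off a compact subset of `O`.
This turns a function holomorphic only near a support into one defining forms of every order. -/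
theorem exists_contDiff_eq_nhdsSet {P O : Set ℂ} (hP : IsCompact P) (hO : IsOpen O) (hPO : P ⊆ O)
    {f : ℂ → ℂ} (hf : DifferentiableOn ℂ f O) :
    ∃ g : ℂ → ℂ, ContDiff ℝ (⊤ : ℕ∞) g ∧ HasCompactSupport g ∧ ∀ᶠ z in 𝓝ˢ P, g z = f z := by
  obtain ⟨L, hL, hPL, hLO⟩ := exists_compact_between hP hO hPO
  obtain ⟨φ, h1, h0, -⟩ := exists_contMDiffMap_one_nhds_of_subset_interior (n := (⊤ : ℕ∞))
    𝓘(ℝ, ℂ) hP.isClosed hPL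
  have hφ : ContDiff ℝ (⊤ : ℕ∞) φ := φ.contMDiff.contDiff
  refine ⟨fun z => φ z • f z, ?_, HasCompactSupport.intro hL fun z hz => by simp [h0 z hz], ?_⟩
  · rw [contDiff_iff_contDiffAt]
    intro z
    by_cases hz : z ∈ O
    · have := ((hf.contDiffOn hO (n := (⊤ : ℕ∞))).contDiffAt (hO.mem_nhds hz)).restrict_scalars ℝ
      exact hφ.contDiffAt.smul this
    · have hzL : z ∈ Lᶜ := fun h => hz (hLO h)
      refine (contDiffAt_const (c := (0 : ℂ))).congr_of_eventuallyEq ?_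
      filter_upwards [hL.isClosed.isOpen_compl.mem_nhds hzL] with y hy
      simp [h0 y hy]
  · filter_upwards [h1] with z hz
    simp [hz]

theorem exists_contDiff_eq_inv {δ : ℝ} (hδ : 0 < δ) (R : ℝ) :
    ∃ κ : ℂ → ℂ, ContDiff ℝ (⊤ : ℕ∞) κ ∧ HasCompactSupport κ ∧
      ∀ z, δ ≤ ‖z‖ → ‖z‖ ≤ R → κ z = z⁻¹ := by
  have hc : IsCompact {z : ℂ | δ ≤ ‖z‖ ∧ ‖z‖ ≤ R} := by
    refine Metric.isCompact_of_isClosed_isBounded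
      ((isClosed_le continuous_const continuous_norm).inter
        (isClosed_le continuous_norm continuous_const))
      ((Metric.isBounded_closedBall (x := (0 : ℂ)) (r := R)).subset fun z hz => ?_)
    simpa using hz.2
  obtain ⟨κ, h1, h2, h3⟩ := exists_contDiff_eq_nhdsSet hc (isOpen_ne (x := (0 : ℂ)))
    (fun z hz => norm_pos_iff.1 (hδ.trans_le hz.1)) (f := fun z => z⁻¹)
    (fun z hz => (differentiableAt_inv hz).differentiableWithinAt)
  exact ⟨κ, h1, h2, fun z hz hz' => h3.self_of_nhdsSet z ⟨hz, hz'⟩⟩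

theorem formDz_congr {f g : ℂ → ℂ} {p : ℂ} (h : f p = g p) : formDz f p = formDz g p := by
  simp only [formDz, h]

/-- Interchange of an integral with a finite sum. The continuity half supplies integrability in the
induction and measurability later. -/
theorem evalForm_formDz_integral {h κ : ℂ → ℂ} (hh : Continuous h) (hc : HasCompactSupport h)
    (hκ : Continuous κ) (c : ℂ) (A : ℂ →₀ Vec1) :
    (Continuous fun z => evalForm (formDz fun w => κ (w - z)) A) ∧
    evalForm (formDz fun w => c * ∫ z, h z * κ (w - z)) A =
      c * ∫ z, h z * evalForm (formDz fun w => κ (w - z)) A := by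
  induction A using Finsupp.induction_linear with
  | zero => simpa using continuous_const
  | add A B hA hB =>
    simp only [map_add, mul_add]
    have hi : ∀ B, (Continuous fun z => evalForm (formDz fun w => κ (w - z)) B) →
        Integrable fun z => h z * evalForm (formDz fun w => κ (w - z)) B := fun B hB =>
      (hh.mul hB).integrable_of_hasCompactSupport hc.mul_right
    exact ⟨hA.1.add hB.1, by rw [integral_add (hi A hA.1) (hi B hB.1), mul_add, hA.2, hB.2]⟩
  | single p α =>
    simp only [evalForm_single, formDz]
    simp only [smul_apply, ContinuousLinearMap.id_apply, smul_eq_mul]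
    refine ⟨by fun_prop, ?_⟩
    simp only [← mul_assoc, integral_mul_const]

/-- The integral of `g dz`, with `g` holomorphic near the support, in terms of winding numbers. -/
theorem pairing_formDz_eq_integral {r : ℕ} {J : Chain Vec1 r} (hJ : IsCompact (supp J))
    {g : ℂ → ℂ} (hg : ContDiff ℝ (⊤ : ℕ∞) g) (hc : HasCompactSupport g)
    (hd : ∀ᶠ z in 𝓝ˢ (supp J), DifferentiableAt ℂ g z) :
    pairing (formDz g) (isBForm_formDz hg hc r) J = ∫ z, dbar g z * windingNumber J z := by
  obtain ⟨N, hNo, hJN, hN⟩ := eventually_nhdsSet_iff_exists.1 hd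
  obtain ⟨ε, hε, hεN⟩ := hJ.exists_thickening_subset_open hNo hJN
  have hδ := half_pos hε
  obtain ⟨R1, hR1⟩ := (hasCompactSupport_dbar hc).isCompact.isBounded.exists_norm_le
  obtain ⟨R2, hR2⟩ := (hJ.isBounded.thickening (δ := ε / 2)).exists_norm_le
  obtain ⟨κ, hκ, hκc, hκe⟩ := exists_contDiff_eq_inv hδ (R1 + R2)
  -- Where `dbar g` is nonzero, `z` is at distance at least `ε` from `supp J`, leaving `ε / 2`
  -- between `z` and `w`; `R1 + R2` bounds ‖w - z‖ from above. So `κ` is the true kernel there.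
  have hκz : ∀ z, dbar g z ≠ 0 → ∀ w ∈ Metric.thickening (ε / 2) (supp J),
      κ (w - z) = (w - z)⁻¹ := fun z hz w hw => by
    refine hκe _ ?_ ?_
    · by_contra! hlt
      obtain ⟨x, hx, hxw⟩ := Metric.mem_thickening_iff.1 hw
      refine hz (dbar_eq_zero (hN z (hεN (Metric.mem_thickening_iff.2 ⟨x, hx, ?_⟩))))
      rw [← dist_eq_norm, dist_comm] at hlt
      linarith [dist_triangle z w x]
    · have := hR1 z (subset_tsupport _ hz)
      linarith [norm_sub_le w z, hR2 w hw]
  have hth : ∀ᶠ w in 𝓝ˢ (supp J), w ∈ Metric.thickening (ε / 2) (supp J) :=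
    Metric.isOpen_thickening.mem_nhdsSet.2 (Metric.self_subset_thickening hδ _)
  obtain ⟨C, hC⟩ := (isBForm_formDz hκ hκc r).exists_bBound
  -- Translation preserves difference bounds, so `C` is the same for all `z`; this gives both the
  -- bound on `G` and the dominating function below.
  have hCz : ∀ z, BBound r C (formDz fun w => κ (w - z)) := fun z => by
    have := hC.translate (-z)
    simp only [← sub_eq_add_neg] at this
    exact this
  have hwind : ∀ z, dbar g z ≠ 0 →
      windingNumber J z = (2 * Real.pi * I)⁻¹ * pairing _ (hCz z).isBForm J := fun z hz => by
    rw [windingNumber, harrisonIntegral_eq_pairing (hCz z).isBForm]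
    filter_upwards [hth] with w hw
    exact formDz_congr (hκz z hz w hw)
  have hbc := (contDiff_dbar hg).continuous
  have hbs := hasCompactSupport_dbar hc
  have hcont := fun A => (evalForm_formDz_integral hbc hbs hκ.continuous (2 * Real.pi * I)⁻¹ A).1
  have heval := fun A => (evalForm_formDz_integral hbc hbs hκ.continuous (2 * Real.pi * I)⁻¹ A).2
  set G : ℂ → ℂ := fun w => (2 * Real.pi * I)⁻¹ * ∫ z, dbar g z * κ (w - z) with hG
  have hbi : Integrable fun z => ‖dbar g z‖ :=
    (hbc.integrable_of_hasCompactSupport hbs).norm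
  have hGB : IsBForm r (formDz G) := by
    refine ⟨‖(2 * Real.pi * I : ℂ)⁻¹‖ * ((∫ z, ‖dbar g z‖) * C), fun e he => ?_⟩
    rw [heval, norm_mul, mul_assoc ‖(2 * Real.pi * I : ℂ)⁻¹‖]
    refine mul_le_mul_of_nonneg_left ?_ (norm_nonneg _)
    rw [mul_assoc, ← integral_mul_const]
    refine norm_integral_le_of_norm_le (hbi.mul_const _) (Eventually.of_forall fun z => ?_)
    rw [norm_mul]
    exact mul_le_mul_of_nonneg_left ((hCz z).evalForm_chain_le e he) (norm_nonneg _)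
  have hGg : ∀ᶠ w in 𝓝ˢ (supp J), formDz G w = formDz g w := by
    filter_upwards [hth] with w hw
    refine formDz_congr ?_
    have hwN : w ∈ N := hεN (Metric.thickening_mono (half_le_self hε.le) _ hw)
    have := integral_inv_mul_dbar hg hc (w := w) (by
      filter_upwards [hNo.mem_nhds hwN] with z hz using hN z hz)
    have e : ∀ z, dbar g z * κ (w - z) = dbar g z * (w - z)⁻¹ := fun z => by
      by_cases hz : dbar g z = 0
      · simp [hz]
      · rw [hκz z hz w hw]
    simp only [hG, e]
    rw [this]
    field_simp [Real.pi_ne_zero, I_ne_zero]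
  rw [← harrisonIntegral_eq_pairing (isBForm_formDz hg hc r) (Eventually.of_forall fun _ => rfl),
    harrisonIntegral_eq_pairing hGB hGg]
  -- The interchange is known for pointed chains; it passes to `J` by dominated convergence, as a
  -- convergent sequence has norms bounded by some `M`.
  obtain ⟨A, hA⟩ := exists_seq_tendsto J
  obtain ⟨M, hM⟩ := hA.norm.bddAbove_range
  refine tendsto_nhds_unique (((pairing _ hGB).continuous.tendsto J).comp hA) ?_
  have e1 : (pairing _ hGB) ∘ (fun n => toChain r (A n)) = fun n =>
      ∫ z, (2 * Real.pi * I)⁻¹ * (dbar g z * evalForm (formDz fun w => κ (w - z)) (A n)) := by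
    ext1 n
    rw [Function.comp_apply, pairing_toChain, heval, integral_const_mul]
  rw [e1]
  refine tendsto_integral_of_dominated_convergence
    (fun z => ‖(2 * Real.pi * I : ℂ)⁻¹‖ * (‖dbar g z‖ * (C * M)))
    (fun n => (continuous_const.mul (hbc.mul (hcont (A n)))).aestronglyMeasurable)
    ((hbi.mul_const _).const_mul _) (fun n => Eventually.of_forall fun z => ?_)
    (Eventually.of_forall fun z => ?_)
  · rw [norm_mul, norm_mul]
    refine mul_le_mul_of_nonneg_left (mul_le_mul_of_nonneg_left ?_ (norm_nonneg _)) (norm_nonneg _)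
    refine ((hCz z).evalForm_le (A n)).trans (mul_le_mul_of_nonneg_left ?_ hC.nonneg)
    rw [← norm_toChain]
    exact hM (Set.mem_range_self n)
  · by_cases hz : dbar g z = 0
    · simp [hz]
    · rw [hwind z hz, mul_left_comm]
      refine ((Tendsto.const_mul _ ?_).const_mul _)
      have := ((pairing _ (hCz z).isBForm).continuous.tendsto J).comp hA
      refine this.congr fun n => ?_
      rw [Function.comp_apply, pairing_toChain]

/-- The argument of the logarithm is $(w-z)/(w-z')$, within distance 1 of 1, so the principal branch
is a single-valued primitive of the difference of two Cauchy kernels. -/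
theorem hasDerivAt_log_div {z z' w : ℂ} (h : ‖z' - z‖ < ‖w - z'‖) :
    HasDerivAt (fun w => log (1 + (z' - z) / (w - z'))) ((w - z)⁻¹ - (w - z')⁻¹) w := by
  have h' : w - z' ≠ 0 := norm_pos_iff.1 ((norm_nonneg _).trans_lt h)
  have h2 : w - z ≠ 0 := fun h3 => by
    rw [sub_eq_zero.1 h3, norm_sub_rev] at h
    exact lt_irrefl _ h
  have h3 : 1 + (z' - z) / (w - z') ∈ slitPlane := mem_slitPlane_of_norm_lt_one (by
    rwa [norm_div, div_lt_one (norm_pos_iff.2 h')])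
  have h4 : HasDerivAt (fun w => 1 + (z' - z) / (w - z')) (-(z' - z) / (w - z') ^ 2) w := by
    have := ((hasDerivAt_const w (z' - z)).div ((hasDerivAt_id w).sub_const z') h').const_add 1
    simpa using this
  refine (h4.clog h3).congr_deriv ?_
  have h5 : 1 + (z' - z) / (w - z') = (w - z) / (w - z') := by
    field_simp
    ring
  rw [h5]
  field_simp
  ring

/-- The winding number is locally constant off the support. -/
theorem windingNumber_eq {s : ℕ} {J : Chain Vec1 (s + 1)} (hJ : boundary1 s J = 0)
    (hJc : IsCompact (supp J)) {z z' : ℂ} (h : ∀ w ∈ supp J, 2 * ‖z' - z‖ < ‖w - z‖) :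
    windingNumber J z' = windingNumber J z := by
  have hz : ∀ w ∈ supp J, w - z ≠ 0 := fun w hw =>
    norm_pos_iff.1 ((by positivity : (0 : ℝ) ≤ 2 * ‖z' - z‖).trans_lt (h w hw))
  have hz' : ∀ w ∈ supp J, ‖z' - z‖ < ‖w - z'‖ := fun w hw => by
    have h1 := norm_sub_le_norm_sub_add_norm_sub w z' z
    linarith [h w hw]
  have hinv : ∀ a : ℂ, (∀ w ∈ supp J, w - a ≠ 0) → ∃ k : ℂ → ℂ, ContDiff ℝ (⊤ : ℕ∞) k ∧
      HasCompactSupport k ∧ ∀ᶠ w in 𝓝ˢ (supp J), k w = (w - a)⁻¹ := fun a ha =>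
    exists_contDiff_eq_nhdsSet hJc (isOpen_ne (x := a)) (fun w hw => sub_ne_zero.1 (ha w hw))
      fun w hw => ((differentiableAt_id.sub_const a).inv
        (sub_ne_zero.2 hw)).differentiableWithinAt
  obtain ⟨k, hk, hkc, hke⟩ := hinv z hz
  obtain ⟨k', hk', hkc', hke'⟩ := hinv z' fun w hw =>
    norm_pos_iff.1 ((norm_nonneg _).trans_lt (hz' w hw))
  obtain ⟨q, hq, hqc, hqe⟩ := exists_contDiff_eq_nhdsSet hJc
    (isOpen_lt (f := fun _ => ‖z' - z‖) (g := fun w => ‖w - z'‖) (by fun_prop) (by fun_prop)) hz'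
    fun w hw => (hasDerivAt_log_div hw).differentiableAt.differentiableWithinAt
  have hB := isBForm_formDz hk hkc (s + 1)
  have hB' := isBForm_formDz hk' hkc' (s + 1)
  have hBq : IsBForm (s + 1) (fderiv ℝ q) :=
    isBForm_of_contDiff (hq.fderiv_right (m := (⊤ : ℕ∞)) le_rfl) (hqc.fderiv ℝ) _
  have hlt : ∀ᶠ w in 𝓝ˢ (supp J), ‖z' - z‖ < ‖w - z'‖ :=
    (isOpen_lt (f := fun _ => ‖z' - z‖) (g := fun w => ‖w - z'‖) (by fun_prop)
      (by fun_prop)).mem_nhdsSet.2 hz'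
  -- Near `supp J` the difference of the two kernel forms is the exact form `dq`, whose integral
  -- over the closed chain `J` is zero.
  have hdq : ∀ᶠ w in 𝓝ˢ (supp J), fderiv ℝ q w = formDz k w - formDz k' w := by
    have := eventually_nhdsSet_iff_exists.1 hqe
    obtain ⟨N, hNo, hJN, hN⟩ := this
    filter_upwards [hNo.mem_nhdsSet.2 hJN, hlt, hke, hke'] with w hw h1 h2 h3
    have hd : HasDerivAt q ((w - z)⁻¹ - (w - z')⁻¹) w :=
      (hasDerivAt_log_div h1).congr_of_eventuallyEq (by
        filter_upwards [hNo.mem_nhds hw] with y hy using hN y hy)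
    rw [hd.complexToReal_fderiv.fderiv]
    ext
    simp [formDz, h2, h3]
    ring
  have h1 := harrisonIntegral_eq_pairing (hB.sub hB') (J := J) (ω := fderiv ℝ q)
    (hdq.mono fun _ h => h.symm)
  rw [harrisonIntegral_eq_pairing hBq (Eventually.of_forall fun _ => rfl),
    pairing_fderiv_eq_zero hq hqc hJ, pairing_sub hB hB'] at h1
  rw [windingNumber, windingNumber,
    harrisonIntegral_eq_pairing hB' (hke'.mono fun w h => formDz_congr h),
    harrisonIntegral_eq_pairing hB (hke.mono fun w h => formDz_congr h),
    sub_eq_zero.1 h1.symm]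

end Winding


theorem eventually_windingNumber_eq {s : ℕ} {J : Chain Vec1 (s + 1)} (hJ : boundary1 s J = 0)
    (hJc : IsCompact (supp J)) {z : ℂ} (hz : z ∉ supp J) :
    ∀ᶠ z' in 𝓝 z, z' ∉ supp J ∧ windingNumber J z' = windingNumber J z := by
  obtain ⟨ε, hε, hb⟩ := Metric.isOpen_iff.1 hJc.isClosed.isOpen_compl z hz
  -- Points of `supp J` are at distance at least `ε` from `z`; the radius `ε / 2` provides the
  -- factor 2 that `windingNumber_eq` asks for.
  filter_upwards [Metric.ball_mem_nhds z (half_pos hε)] with z' hz'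
  rw [Metric.mem_ball, dist_eq_norm] at hz'
  refine ⟨hb ?_, windingNumber_eq hJ hJc fun w hw => ?_⟩
  · rw [Metric.mem_ball, dist_eq_norm]
    linarith
  · by_contra! hle
    refine hb (a := w) ?_ hw
    rw [Metric.mem_ball, dist_eq_norm]
    linarith

/-- Off the support the index is locally constant, so its zeros there form an open set. -/
theorem isClosed_supp_union_windingNumber_ne_zero {s : ℕ} {J : Chain Vec1 (s + 1)}
    (hJ : boundary1 s J = 0) (hJc : IsCompact (supp J)) :
    IsClosed (supp J ∪ {z | windingNumber J z ≠ 0}) := by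
  rw [← isOpen_compl_iff, isOpen_iff_mem_nhds]
  intro z hz
  rw [Set.mem_compl_iff, Set.mem_union, not_or] at hz
  filter_upwards [eventually_windingNumber_eq hJ hJc hz.1] with z' hz'
  rintro (h | h)
  · exact hz'.1 h
  · exact h (hz'.2.trans (not_not.1 hz.2))

end DiffChain

end

/-! ### The residue theorem. -/

theorem mainTheorem2 (s : ℕ) (U : Set ℂ) (hUo : IsOpen U) (hUb : Bornology.IsBounded U)
    (J : Chain Vec1 (s + 1)) (hJclosed : boundary1 s J = 0) (hJU : supp J ⊆ U)
    (hInd : ∀ w ∉ U, windingNumber J w = 0)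
    (hK : ∃ K : Chain Vec2 s, mass K < ⊤ ∧ IsBoundaryOf J K)
    (S : Finset ℂ) (hS : (S : Set ℂ) ⊆ U \ supp J)
    (f : ℂ → ℂ) (hf : DifferentiableOn ℂ f (U \ S))
    (D : ℂ → Set ℂ) (hDo : ∀ a ∈ S, IsOpen (D a)) (hDa : ∀ a ∈ S, a ∈ D a)
    (hDU : ∀ a ∈ S, closure (D a) ⊆ U)
    (hDS : ∀ a ∈ S, ∀ b ∈ S, b ≠ a → b ∉ closure (D a)) :
    IsHarrisonIntegrable J (formDz f) ∧
    (∀ a ∈ S, IsHarrisonIntegrable (boundary2 0 (openSetChain (D a))) (formDz f)) ∧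
    harrisonIntegral J (formDz f) =
      ∑ a ∈ S, windingNumber J a *
        harrisonIntegral (boundary2 0 (openSetChain (D a))) (formDz f) := by
  have hJc : IsCompact (supp J) :=
    Metric.isCompact_of_isClosed_isBounded (isClosed_supp J) (hUb.subset hJU)
  set H := supp J ∪ {z | windingNumber J z ≠ 0}
  have hHc : IsClosed H := isClosed_supp_union_windingNumber_ne_zero hJclosed hJc
  have hHU : H ⊆ U := Set.union_subset hJU fun z hz => by
    by_contra h
    exact hz (hInd z h)
  -- The `D a` may overlap. Keeping `B a` inside `D a` and off the closures of the other `D b` makes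
  -- the `B a` disjoint, and makes each `D b` see only its own `B b`.
  have hB : ∀ a ∈ S, ∃ B : Set ℂ, IsOpen B ∧ a ∈ B ∧ ∀ z ∈ B,
      (z ∉ supp J ∧ windingNumber J z = windingNumber J a) ∧ z ∈ D a ∧
        ∀ b ∈ S, b ≠ a → z ∉ closure (D b) := by
    intro a ha
    have h1 := eventually_windingNumber_eq hJclosed hJc (hS ha).2
    have h2 : ∀ᶠ z in 𝓝 a, z ∈ D a := (hDo a ha).mem_nhds (hDa a ha)
    have h3 : ∀ᶠ z in 𝓝 a, ∀ b ∈ S, b ≠ a → z ∉ closure (D b) := by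
      rw [Filter.eventually_all_finset]
      intro b hb
      by_cases hba : b = a
      · exact Eventually.of_forall fun z h => absurd hba h
      · filter_upwards [isClosed_closure.isOpen_compl.mem_nhds
          (hDS b hb a ha (Ne.symm hba))] with z hz _ using hz
    obtain ⟨B, hB, hBo, haB⟩ := eventually_nhds_iff.1 (h1.and (h2.and h3))
    exact ⟨B, hBo, haB, hB⟩
  choose! B hBo haB hBp using hB
  -- `P` contains all the supports involved and every point outside the `B a` where `dbar g` could
  -- contribute, yet no pole.
  set P := (H ∪ ⋃ a ∈ S, closure (D a)) \ ⋃ a ∈ S, B a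
  have hPU : P ⊆ U \ S := fun z hz => by
    refine ⟨?_, fun hzS => hz.2 (Set.mem_biUnion hzS (haB z hzS))⟩
    rcases hz.1 with h | h
    · exact hHU h
    · obtain ⟨a, ha, hza⟩ := Set.mem_iUnion₂.1 h
      exact hDU a ha hza
  have hPc : IsCompact P := by
    refine Metric.isCompact_of_isClosed_isBounded ?_ (hUb.subset (hPU.trans Set.sdiff_subset))
    exact (hHc.union (S.finite_toSet.isClosed_biUnion fun _ _ => isClosed_closure)).sdiff
      (isOpen_biUnion hBo)
  have hUS : IsOpen (U \ S) := hUo.sdiff S.finite_toSet.isClosed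
  obtain ⟨g, hg, hgc, hgf⟩ := exists_contDiff_eq_nhdsSet hPc hUS hPU hf
  have hgd : ∀ᶠ z in 𝓝ˢ P, DifferentiableAt ℂ g z := by
    obtain ⟨N, hNo, hPN, hN⟩ := eventually_nhdsSet_iff_exists.1 hgf
    filter_upwards [hNo.mem_nhdsSet.2 hPN, hUS.mem_nhdsSet.2 hPU] with z hz hzU
    refine (hf.differentiableAt (hUS.mem_nhds hzU)).congr_of_eventuallyEq ?_
    filter_upwards [hNo.mem_nhds hz] with y hy using hN y hy
  have hdbar : ∀ z ∈ P, dbar g z = 0 := fun z hz => dbar_eq_zero (hgd.self_of_nhdsSet z hz)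
  have hJP : supp J ⊆ P := fun z hz => ⟨Or.inl (Or.inl hz), fun h => by
    obtain ⟨a, ha, hza⟩ := Set.mem_iUnion₂.1 h
    exact (hBp a ha z hza).1.1 hz⟩
  have hDP : ∀ a ∈ S, closure (D a) \ B a ⊆ P := fun a ha z hz =>
    ⟨Or.inr (Set.mem_biUnion ha hz.1), fun h => by
      obtain ⟨b, hb, hzb⟩ := Set.mem_iUnion₂.1 h
      rcases eq_or_ne a b with rfl | hab
      · exact hz.2 hzb
      · exact (hBp b hb z hzb).2.2 a ha hab hz.1⟩
  have hTP : ∀ a ∈ S, supp (boundary2 0 (openSetChain (D a))) ⊆ P := fun a ha => by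
    refine (supp_boundary2_openSetChain_subset (hDo a ha)
      ((hUb.subset (hDU a ha)).subset subset_closure)).trans fun z hz =>
        hDP a ha ⟨frontier_subset_closure hz, fun hzB => ?_⟩
    rw [(hDo a ha).frontier_eq] at hz
    exact hz.2 (hBp a ha z hzB).2.1
  have hgf' : ∀ X ⊆ P, ∀ᶠ z in 𝓝ˢ X, formDz g z = formDz f z := fun X hX =>
    (hgf.filter_mono (nhdsSet_mono hX)).mono fun _ h => formDz_congr h
  have hJint := hasHarrisonIntegral_pairing (isBForm_formDz hg hgc (s + 1)) (hgf' _ hJP)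
  have hTint := fun a ha =>
    hasHarrisonIntegral_pairing (isBForm_formDz hg hgc (0 + 2)) (hgf' _ (hTP a ha))
  refine ⟨⟨_, hJint⟩, fun a ha => ⟨_, hTint a ha⟩, ?_⟩
  -- Stokes gives the integral of `dbar g` over `D a`; the part outside `B a` lies in `P` and
  -- contributes nothing.
  have hTval : ∀ a ∈ S, harrisonIntegral (boundary2 0 (openSetChain (D a))) (formDz f) =
      ∫ z in B a, dbar g z := fun a ha => by
    rw [(hTint a ha).harrisonIntegral_eq, pairing_boundary2 hg hgc,
      pairing_openSetChain _ ((hUb.subset (subset_closure.trans (hDU a ha))).measure_lt_top.ne)]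
    simp only [form2, ContinuousLinearMap.smulRight_apply, ContinuousLinearMap.id_apply, one_smul]
    refine setIntegral_eq_of_subset_of_forall_sdiff_eq_zero (hDo a ha).measurableSet
      (fun z hz => (hBp a ha z hz).2.1) fun z hz => hdbar z (hDP a ha ⟨subset_closure hz.1, hz.2⟩)
  rw [hJint.harrisonIntegral_eq,
    pairing_formDz_eq_integral hJc hg hgc (hgd.filter_mono (nhdsSet_mono hJP))]
  -- Inside `B a` only the summand of `a` survives, by disjointness. Outside all of them, either the
  -- index is zero or `z` lies in `P` and `dbar g` is zero.
  have hpt : ∀ z, dbar g z * windingNumber J z =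
      ∑ a ∈ S, (B a).indicator (fun z => windingNumber J a * dbar g z) z := fun z => by
    by_cases hz : ∃ a ∈ S, z ∈ B a
    · obtain ⟨a, ha, hza⟩ := hz
      rw [Finset.sum_eq_single_of_mem a ha fun b hb hba => Set.indicator_of_notMem (fun hzb =>
        (hBp a ha z hza).2.2 b hb hba (subset_closure (hBp b hb z hzb).2.1)) _,
        Set.indicator_of_mem hza, (hBp a ha z hza).1.2, mul_comm]
    · have hzB : ∀ a ∈ S, z ∉ B a := fun a ha h => hz ⟨a, ha, h⟩
      rw [Finset.sum_eq_zero fun a ha => Set.indicator_of_notMem (hzB a ha) _, mul_eq_zero]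
      by_contra! h
      exact h.1 (hdbar z ⟨Or.inl (Or.inr h.2), fun hzU => by
        obtain ⟨a, ha, hza⟩ := Set.mem_iUnion₂.1 hzU
        exact hzB a ha hza⟩)
  have hi : Integrable (dbar g) :=
    (contDiff_dbar hg).continuous.integrable_of_hasCompactSupport (hasCompactSupport_dbar hgc)
  simp only [hpt]
  rw [integral_finsetSum _ fun a ha => (integrable_indicator_iff (hBo a ha).measurableSet).2
    (hi.const_mul _).integrableOn]
  refine Finset.sum_congr rfl fun a ha => ?_
  rw [integral_indicator (hBo a ha).measurableSet, integral_const_mul, hTval a ha]
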